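/- There are absolute constants $C_0, C_1, C_2 > 0$ such that the following holds. Let $n \ge 2$, $\epsilon \in (0, 1/2]$, $p \in [0,1]$ with $p \ge C_1 \log(n)/n$, and let $k$ be an integer with $k \ge C_2 \log(n)/\epsilon^2$. Let $\mathcal{G}_{\mathrm{ER}} \sim G(n,p)$ be an Erdős–Rényi graph on $\mathcal{V}=[n]$, and let $\mathcal{G}_{\mathrm{SR}} = (\mathcal{V}, \mathcal{E}_{\mathrm{SR}})$ be obtained from it by an adversary who observes $\mathcal{G}_{\mathrm{ER}}$ and adds edges arbitrarily. For $i \neq j$ put $L_{ij} = (e_i - e_j)(e_i-e_j)^\top$; for edge weights $w$ put $L_w = \sum_{ij \in \mathcal{E}_{\mathrm{SR}}} w_{ij} L_{ij}$. Write $\langle A, B\rangle = \mathrm{tr}(A^\top B)$, and let $\Pi$ be the orthogonal projector onto the orthogonal complement of the all-ones vector. Define $$\mathcal{F} = \Big\{ w \in \mathbb{R}_{\ge 0}^{\mathcal{E}_{\mathrm{SR}}} : \sum_{j : ij \in \mathcal{E}_{\mathrm{SR}}} w_{ij} \le 2np \ \ \forall i \in \mathcal{V}, \quad w_{ij} \le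 1 \ \ \forall ij \in \mathcal{E}_{\mathrm{SR}} \Big\},$$ $$\Delta = \{ X \in \mathbb{R}^{n \times n} \text{ symmetric} : X \succeq 0, \ \langle \Pi, X \rangle = 1\}, \qquad \mathrm{OPT} = \max_{w \in \mathcal{F}} \min_{X \in \Delta} \langle L_w, X\rangle .$$ Consider the following algorithm. Put $w^{(0)} = 0$, $\eta = \epsilon/(4pn)$, $T = \lceil 8\log(n)/\epsilon^2 \rceil$. For $t = 0, \dots, T-1$: sample $R \in \{\pm 1/\sqrt{k}\}^{n \times k}$ uniformly at random, independently of everything before; compute $U = \exp(-\eta L_{w^{(t)}}) R$ and $V = U / \sqrt{\langle \Pi, U U^\top \rangle}$; compute the gains $c_{ij} = \langle L_{ij}, V V^\top\rangle$ for $ij \in \mathcal{E}_{\mathrm{SR}}$; obtain from an oracle an approximate solution $\hat w^{(t)} \in \mathcal{F}$ of $\max_{w \in \mathcal{F}} \langle c, w\rangle$; and set $w^{(t+1)} = w^{(t)} + \hat w^{(t)}$. Output $w_{\mathrm{out}} = \frac{1}{T} \sum_{t=0}^{T-1} \hat w^{(t)}$. The oracle may be randomized and may depend on the past, and it is one of the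 following: * the LP oracle: any procedure returning $\hat w \in \mathcal{F}$ with $\langle c, \hat w \rangle \ge (1-\epsilon) \max_{w \in \mathcal{F}} \langle c, w\rangle$; * the greedy oracle: the procedure that runs once through the edges in decreasing order of gain and gives each edge the largest weight, at most $1$, that keeps the weighted degrees of both its endpoints at most $2np$; or, more generally, any procedure returning $\hat w \in \mathcal{F}$ with $\langle c, \hat w \rangle \ge \frac12 \max_{w \in \mathcal{F}} \langle c, w\rangle$. Then, with probability at least $1 - n^{-10}$ over the random graph and the algorithm's randomness, $w_{\mathrm{out}} \in \mathcal{F}$ and $$\min_{X \in \Delta} \langle L_{w_{\mathrm{out}}}, X \rangle \ \ge\ \begin{cases} (1 - C_0\epsilon)\cdot \mathrm{OPT}, & \text{if the LP oracle is used},\\ (\tfrac12 - C_0 \epsilon) \cdot \mathrm{OPT}, & \text{if the greedy oracle is used}.\end{cases}$$ -/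

import Mathlib

open MeasureTheory ProbabilityTheory
open scoped SimpleGraph

namespace MMWU

noncomputable section

/-- Edge weights on the vertex set `Fin n`, indexed by unordered pairs. A weighting of a graph `G` is
one that vanishes outside the edge set of `G`. -/
abbrev Weights (n : ℕ) : Type := Sym2 (Fin n) → ℝ

/-- Entrywise (trace) inner product of real matrices. -/
def matInner {n : ℕ} (A B : Matrix (Fin n) (Fin n) ℝ) : ℝ :=
  ∑ i, ∑ j, A i j * B i j

/-- The Laplacian `(e_i - e_j)(e_i - e_j)ᵀ` of the single edge `{i, j}`. -/
def edgeLap {n : ℕ} (e : Sym2 (Fin n)) : Matrix (Fin n) (Fin n) ℝ :=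
  Sym2.lift ⟨fun i j =>
    Matrix.vecMulVec (Pi.single i (1 : ℝ) - Pi.single j 1) (Pi.single i (1 : ℝ) - Pi.single j 1),
    fun i j => by
      ext a b
      simp only [Matrix.vecMulVec_apply, Pi.sub_apply]
      ring⟩ e

/-- The weighted Laplacian `L_w = ∑ w_ij (e_i - e_j)(e_i - e_j)ᵀ`. -/
def lap {n : ℕ} (w : Weights n) : Matrix (Fin n) (Fin n) ℝ :=
  ∑ e, w e • edgeLap e

/-- The orthogonal projector onto the complement of the all-ones vector. -/
def projPerpOnes (n : ℕ) : Matrix (Fin n) (Fin n) ℝ :=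
  1 - Matrix.of fun _ _ => (1 / n : ℝ)

/-- The set `Δ` of positive semidefinite `X` with `⟨Π, X⟩ = 1`, where `Π` projects onto `1^⊥`. -/
def specSet (n : ℕ) : Set (Matrix (Fin n) (Fin n) ℝ) :=
  {X | X.PosSemidef ∧ matInner (projPerpOnes n) X = 1}

/-- The weighted degree of a vertex. -/
def wdeg {n : ℕ} (w : Weights n) (i : Fin n) : ℝ := ∑ j, w s(i, j)

/-- The feasible set `F`: nonnegative weights on the edges of `G`, at most `1` on each edge, with all
weighted degrees at most `2np`. -/
def feasible {n : ℕ} (G : SimpleGraph (Fin n)) (p : ℝ) : Set (Weights n) :=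
  {w | (∀ e, 0 ≤ w e) ∧ (∀ e, e ∉ G.edgeSet → w e = 0) ∧
    (∀ i, wdeg w i ≤ 2 * n * p) ∧ (∀ e ∈ G.edgeSet, w e ≤ 1)}

/-- The spectral objective `min_{X ∈ Δ} ⟨L_w, X⟩`. For `n ≥ 2` and `w ≥ 0` the set of values is
nonempty and bounded below by `0`. -/
def objective {n : ℕ} (w : Weights n) : ℝ :=
  sInf ((fun X => matInner (lap w) X) '' specSet n)

/-- `OPT = max_{w ∈ F} min_{X ∈ Δ} ⟨L_w, X⟩`. -/
def opt {n : ℕ} (G : SimpleGraph (Fin n)) (p : ℝ) : ℝ :=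
  sSup (objective '' feasible G p)

/-! ### The two oracles for `max_{w ∈ F} ⟨c, w⟩` -/

/-- `w` is feasible and has at least an `α` fraction of the maximum of `⟨c, w'⟩` over `w' ∈ F`. -/
def IsApproxSolution {n : ℕ} (α p : ℝ) (G : SimpleGraph (Fin n)) (c w : Weights n) : Prop :=
  w ∈ feasible G p ∧ ∀ w' ∈ feasible G p, α * ∑ e, c e * w' e ≤ ∑ e, c e * w e

/-- The smaller of the two remaining demands at the endpoints of `e`, when every vertex has total
demand `b`. -/
def residual {n : ℕ} (b : ℝ) (w : Weights n) (e : Sym2 (Fin n)) : ℝ :=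
  Sym2.lift ⟨fun i j => min (b - wdeg w i) (b - wdeg w j), fun _ _ => min_comm _ _⟩ e

/-- One greedy step: put as much weight on `e` (at most `1`) as the remaining demands of its two
endpoints allow. -/
def greedyStep {n : ℕ} (b : ℝ) (w : Weights n) (e : Sym2 (Fin n)) : Weights n :=
  Function.update w e (min 1 (residual b w e))

/-- `w` results from running through the edges of `G` once, in some order of decreasing gain `c`,
and performing a greedy step at each of them, with vertex demands `2np`. -/
def IsGreedySolution {n : ℕ} (p : ℝ) (G : SimpleGraph (Fin n)) (c w : Weights n) : Prop :=
  ∃ l : List (Sym2 (Fin n)), l.Nodup ∧ (∀ e, e ∈ l ↔ e ∈ G.edgeSet) ∧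
    l.Pairwise (fun e e' => c e' ≤ c e) ∧ w = l.foldl (greedyStep (2 * n * p)) 0

/-! ### The algorithm -/

/-- The step size `η = ε / (4pn)`. -/
def stepSize (n : ℕ) (p ε : ℝ) : ℝ := ε / (4 * p * n)

/-- The number of iterations `T = 8 log n / ε²`, rounded up. -/
def numIter (n : ℕ) (ε : ℝ) : ℕ := ⌈8 * Real.log n / ε ^ 2⌉₊

/-- The finite set `{±1/√k}^{n × k}`. -/
def signMatrices (n k : ℕ) : Set (Fin n → Fin k → ℝ) :=
  {R | ∀ i j, R i j = 1 / √(k : ℝ) ∨ R i j = -(1 / √(k : ℝ))}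

/-- `U = exp(-η L_w) R`. -/
def sketch {n k : ℕ} (p ε : ℝ) (w : Weights n) (R : Fin n → Fin k → ℝ) :
    Matrix (Fin n) (Fin k) ℝ :=
  NormedSpace.exp (-(stepSize n p ε) • lap w) * Matrix.of R

/-- `V = U / √⟨Π, U Uᵀ⟩`. -/
def normSketch {n k : ℕ} (p ε : ℝ) (w : Weights n) (R : Fin n → Fin k → ℝ) :
    Matrix (Fin n) (Fin k) ℝ :=
  (√(matInner (projPerpOnes n) (sketch p ε w R * (sketch p ε w R).transpose)))⁻¹ • sketch p ε w R

/-- The edge gains `c_ij = ⟨L_ij, V Vᵀ⟩`. -/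
def gains {n k : ℕ} (p ε : ℝ) (w : Weights n) (R : Fin n → Fin k → ℝ) : Weights n :=
  fun e => matInner (edgeLap e) (normSketch p ε w R * (normSketch p ε w R).transpose)

/-- The accumulated weights `w^(t)`: `w^(0) = 0` and `w^(t+1) = w^(t) + ŵ^(t)`. -/
def accum {n : ℕ} (what : ℕ → Weights n) : ℕ → Weights n
  | 0 => 0
  | t + 1 => accum what t + what t

/-- The output `(1/T) ∑_{t<T} ŵ^(t)`, the average of the oracle answers. -/
def output {n : ℕ} (ε : ℝ) (what : ℕ → Weights n) : Weights n :=
  (1 / (numIter n ε : ℝ)) • ∑ t ∈ Finset.range (numIter n ε), what t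

/-- An execution of the algorithm, as a stochastic process, on the (random) graph `G`, with sketch
dimension `k`. `R t` is the sketching matrix and `what t` the oracle's answer of iteration `t`; the
σ-algebra `ℱ t` describes everything that has happened before iteration `t`, including the choice
of `G` and any internal randomness of the oracle. `solves H c w` says that `w` is an acceptable
answer of the oracle on the graph `H` with gains `c`. -/
structure IsRun {n k : ℕ} {Ω : Type*} [mΩ : MeasurableSpace Ω] (P : Measure Ω)
    (G : Ω → SimpleGraph (Fin n)) (p ε : ℝ)
    (solves : SimpleGraph (Fin n) → Weights n → Weights n → Prop)
    (ℱ : Filtration ℕ mΩ) (R : ℕ → Ω → Fin n → Fin k → ℝ) (what : ℕ → Ω → Weights n) : Prop where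
  graph_measurable : Measurable[ℱ 0] G
  sample_measurable : ∀ t < numIter n ε, Measurable[ℱ (t + 1)] (R t)
  answer_measurable : ∀ t < numIter n ε, Measurable[ℱ (t + 1)] (what t)
  /-- The sketching matrices are uniform ... -/
  sample_law : ∀ t < numIter n ε, HasLaw (R t) (uniformOn (signMatrices n k)) P
  /-- ... and sampled afresh in each iteration. -/
  sample_indep : ∀ t < numIter n ε,
    Indep (MeasurableSpace.comap (R t) inferInstance) (ℱ t) P
  /-- The oracle's answer in iteration `t` is acceptable for the gains of that iteration. -/
  answer_solves : ∀ t < numIter n ε, ∀ ω,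
    solves (G ω) (gains p ε (accum (fun s => what s ω) t) (R t ω)) (what t ω)

end

end MMWU

/-! The algorithm is matrix multiplicative weights for the zero-sum game `⟨L_w, X⟩`, and the proof
tracks the potential `φ(w) = ⟨Π, exp(-s L_w)⟩` with `s = 2η`.

Regret. `trace_exp_sub_le` shows that adding weights `v` with degrees at most `2np` lowers `φ` by at
least `(1 - 2ε) s ⟨L_v, exp(-s L_w)⟩`. Since `exp(-s L_w) / φ(w)` lies in `Δ`, an exact oracle would
make this inner product at least `OPT · φ(w)`, and an `α`-approximate one loses the factor `α`. So
`φ` decays geometrically from `n - 1`. Conversely `φ(w) ≥ exp(-s · objective w)`, so a small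
potential certifies a large objective. After `T` rounds the loss besides the factors `1 - O(ε)` is
`log n / (sT)`.

Random graph. This additive loss is at most `ε OPT` once `OPT ≥ np/4`, and that is all the random
graph has to supply: if the Erdős–Rényi graph has degrees at most `2np` and spectral gap at least
`np/4`, its 0-1 weights are feasible for every supergraph, whatever the adversary adds. The gap is
proved with the same potential: Russo's formula turns the one-edge decrease into a differential
inequality in `p` for the expected potential, because the edge Laplacians of the complete graph sum
to `nΠ`. The degrees are handled in the same way with `2 ^ deg`.

Sketching. The gain of `ij` is, up to a common factor, `‖Rᵀ y‖²` with `y = exp(-ηL_w)(e_i - e_j)`,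
while the exact gain is `‖y‖²`. A Johnson–Lindenstrauss estimate bounds the expected excess of the
relative errors over `ε`. As `R` is independent of the past, the bound holds in every round, and
Markov's inequality applied to the sum over all rounds avoids a union bound over `T`, which is not
bounded in terms of `n`.

The greedy oracle is a `1/2`-approximation by linear programming duality. The theorem follows from
`output_guarantee`, `binomialRandom_not_isWellConnected` and `IsRun.measure_lt_sum_excess_le`. -/

namespace MMWU

/-! ### Trace inequalities for the matrix exponential. -/

section MatrixExponential

open Matrix

variable {m : Type*} [Fintype m] [DecidableEq m]

/-- A real symmetric matrix is orthogonally diagonalizable, and so is its exponential. -/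
lemma exists_spectral {A : Matrix m m ℝ} (hA : A.IsHermitian) :
    ∃ (U : Matrix m m ℝ) (a : m → ℝ), Uᵀ * U = 1 ∧ U * Uᵀ = 1 ∧ A = U * diagonal a * Uᵀ ∧
      NormedSpace.exp A = U * diagonal (fun i => Real.exp (a i)) * Uᵀ := by
  set U : Matrix m m ℝ := (hA.eigenvectorUnitary : Matrix m m ℝ) with hU
  have h1 : Uᵀ * U = 1 := by
    have := (Matrix.mem_unitaryGroup_iff').1 hA.eigenvectorUnitary.2
    simpa [Matrix.star_eq_conjTranspose] using this
  have h2 : U * Uᵀ = 1 := mul_eq_one_comm.1 h1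
  have hinv : U⁻¹ = Uᵀ := Matrix.inv_eq_left_inv h1
  have h3 : A = U * diagonal hA.eigenvalues * Uᵀ := by
    have := hA.spectral_theorem
    rw [Unitary.conjStarAlgAut_apply] at this
    simpa [Matrix.star_eq_conjTranspose, Function.comp_def] using this
  refine ⟨U, hA.eigenvalues, h1, h2, h3, ?_⟩
  have hu : IsUnit U := ⟨⟨U, Uᵀ, h2, h1⟩, rfl⟩
  have h4 := Matrix.exp_conj U (diagonal hA.eigenvalues) hu
  rw [hinv, ← h3, Matrix.exp_diagonal] at h4
  rw [h4]
  congr 3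
  ext i
  rw [Pi.coe_exp, Real.exp_eq_exp_ℝ]

/-- The squared entries of `Uᵀ * V` are the squared overlaps of the two eigenbases. Through them a
trace involving two non-commuting matrices becomes a nonnegatively weighted sum over pairs of
eigenvalues, so scalar inequalities can be applied termwise. -/
lemma trace_conj_mul_conj (U V : Matrix m m ℝ) (f g : m → ℝ) :
    trace (U * diagonal f * Uᵀ * (V * diagonal g * Vᵀ)) =
      ∑ i, ∑ j, f i * g j * (Uᵀ * V) i j ^ 2 := by
  have h : trace (U * diagonal f * Uᵀ * (V * diagonal g * Vᵀ)) =
      trace (diagonal f * (Uᵀ * V) * (diagonal g * (Uᵀ * V)ᵀ)) := by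
    rw [transpose_mul, transpose_transpose, Matrix.trace_mul_comm (diagonal f * (Uᵀ * V)),
      show U * diagonal f * Uᵀ * (V * diagonal g * Vᵀ)
        = U * (diagonal f * (Uᵀ * V) * (diagonal g * Vᵀ)) by simp only [Matrix.mul_assoc],
      Matrix.trace_mul_comm, Matrix.trace_mul_comm _ (diagonal f * (Uᵀ * V))]
    simp only [Matrix.mul_assoc]
  rw [h]
  simp only [trace, diag_apply, Matrix.mul_apply (M := diagonal f * (Uᵀ * V)), diagonal_mul,
    transpose_apply]
  exact Finset.sum_congr rfl fun i _ => Finset.sum_congr rfl fun j _ => by ring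

/-- If `0 ≼ D ≼ ρ`, then `D² ≼ ρ D`. -/
lemma posSemidef_smul_sub_sq {D : Matrix m m ℝ} {ρ : ℝ} (hρ : 0 < ρ) (hD : D.PosSemidef)
    (hDρ : (ρ • (1 : Matrix m m ℝ) - D).PosSemidef) : (ρ • D - D * D).PosSemidef := by
  have hDt : Dᴴ = D := hD.1
  have h1 := hDρ.conjTranspose_mul_mul_same D
  have h2 := hD.conjTranspose_mul_mul_same (ρ • (1 : Matrix m m ℝ) - D)
  have h3 := (h1.add h2).smul (inv_nonneg.2 hρ.le)
  convert h3 using 1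
  rw [hDρ.1.eq, hDt]
  -- The identity `D(ρ - D)D + (ρ - D)D(ρ - D) = ρ(ρD - D²)` writes the claim as a sum of two
  -- congruences of positive semidefinite matrices.
  have : D * (ρ • (1 : Matrix m m ℝ) - D) * D + (ρ • (1 : Matrix m m ℝ) - D) * D *
      (ρ • (1 : Matrix m m ℝ) - D) = ρ • (ρ • D - D * D) := by
    simp only [Matrix.mul_sub, Matrix.sub_mul, Matrix.mul_smul, Matrix.smul_mul, Matrix.mul_one,
      Matrix.one_mul, smul_sub, Matrix.mul_assoc]
    abel
  rw [this, smul_smul, inv_mul_cancel₀ hρ.ne', one_smul]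

lemma exp_posSemidef {A : Matrix m m ℝ} (hA : A.IsHermitian) :
    (NormedSpace.exp A).PosSemidef := by
  obtain ⟨U, a, -, -, -, h⟩ := exists_spectral hA
  rw [h]
  exact (PosSemidef.diagonal fun i => (Real.exp_pos (a i)).le).mul_mul_conjTranspose_same U

lemma exists_eq_mul_transpose {X : Matrix m m ℝ} (hX : X.PosSemidef) :
    ∃ Y : Matrix m m ℝ, X = Y * Yᵀ := by
  obtain ⟨U, b, h1, -, h, -⟩ := exists_spectral hX.1
  have hb : ∀ i, 0 ≤ b i := by
    have h3 : Uᵀ * X * U = diagonal b := by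
      rw [h, show Uᵀ * (U * diagonal b * Uᵀ) * U = (Uᵀ * U) * diagonal b * (Uᵀ * U) by
        simp only [Matrix.mul_assoc], h1, Matrix.one_mul, Matrix.mul_one]
    have h4 : (Uᵀ * X * U).PosSemidef := hX.conjTranspose_mul_mul_same U
    intro i
    have := h4.diag_nonneg (i := i)
    rwa [h3, diagonal_apply_eq] at this
  refine ⟨U * diagonal fun i => √(b i), ?_⟩
  rw [transpose_mul, diagonal_transpose, Matrix.mul_assoc, ← Matrix.mul_assoc (diagonal _),
    diagonal_mul_diagonal, ← Matrix.mul_assoc]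
  simp only [Real.mul_self_sqrt (hb _)]
  exact h

lemma trace_mul_nonneg {A X : Matrix m m ℝ} (hA : A.PosSemidef) (hX : X.PosSemidef) :
    0 ≤ trace (A * X) := by
  obtain ⟨Y, rfl⟩ := exists_eq_mul_transpose hX
  rw [← Matrix.mul_assoc, Matrix.trace_mul_comm, ← Matrix.mul_assoc]
  exact (hA.conjTranspose_mul_mul_same Y).trace_nonneg

lemma one_sub_sq_div_two_le {y : ℝ} (hy : 0 ≤ y) : 1 - y ^ 2 / 2 ≤ (1 + y) * Real.exp (-y) := by
  have hderiv : ∀ z : ℝ, HasDerivAt (fun y : ℝ => (1 + y) * Real.exp (-y) + y ^ 2 / 2)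
      (z * (1 - Real.exp (-z))) z := fun z => by
    have h1 : HasDerivAt (fun y : ℝ => 1 + y) 1 z := (hasDerivAt_id z).const_add 1
    have h2 : HasDerivAt (fun y : ℝ => Real.exp (-y)) (Real.exp (-z) * -1) z :=
      (hasDerivAt_neg z).exp
    have h3 : HasDerivAt (fun y : ℝ => y ^ 2 / 2) (2 * z / 2) z := by
      simpa using (hasDerivAt_pow 2 z).div_const 2
    exact ((h1.mul h2).add h3).congr_deriv (by ring)
  have hmono : MonotoneOn (fun y : ℝ => (1 + y) * Real.exp (-y) + y ^ 2 / 2) (Set.Ici 0) := by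
    refine monotoneOn_of_deriv_nonneg (convex_Ici 0) (by fun_prop)
      (fun z _ => (hderiv z).differentiableAt.differentiableWithinAt) fun z hz => ?_
    rw [interior_Ici, Set.mem_Ioi] at hz
    rw [(hderiv z).deriv]
    exact mul_nonneg hz.le (sub_nonneg.2 (Real.exp_le_one_iff.2 (by linarith)))
  have := hmono (Set.mem_Ici.2 le_rfl) (Set.mem_Ici.2 hy) hy
  norm_num at this
  linarith

lemma exp_neg_le_quadratic {x : ℝ} (hx : 0 ≤ x) : Real.exp (-x) ≤ 1 - x + x ^ 2 / 2 := by
  have h := Real.quadratic_le_exp_of_nonneg hx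
  rw [Real.exp_neg, inv_le_iff_one_le_mul₀ (Real.exp_pos x)]
  -- The product `(1 - x + x²/2)(1 + x + x²/2)` equals `1 + x⁴/4`, which is at least `1`.
  have h1 : 0 ≤ 1 - x + x ^ 2 / 2 := by nlinarith [sq_nonneg (x - 1)]
  have h2 := mul_le_mul_of_nonneg_left h h1
  nlinarith [sq_nonneg (x ^ 2)]

/-- This bounds the Taylor remainder of `exp` at `a` by `(a - b)²/2` times the larger of the two
exponentials. The larger one is replaced by the sum because the sum survives the passage to traces.
-/
lemma exp_sub_exp_add_le (a b : ℝ) :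
    Real.exp b - Real.exp a + (a - b) * Real.exp a ≤
      (a - b) ^ 2 / 2 * (Real.exp a + Real.exp b) := by
  rcases le_total b a with h | h
  · have h1 := mul_le_mul_of_nonneg_left (exp_neg_le_quadratic (sub_nonneg.2 h))
      (Real.exp_pos a).le
    rw [← Real.exp_add, show a + -(a - b) = b by ring] at h1
    have h2 : 0 ≤ (a - b) ^ 2 / 2 * Real.exp b := by positivity
    linarith
  · have h1 := mul_le_mul_of_nonneg_left (one_sub_sq_div_two_le (sub_nonneg.2 h))
      (Real.exp_pos b).le
    rw [mul_left_comm, ← Real.exp_add, show b + -(b - a) = a by ring] at h1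
    have h2 : 0 ≤ (a - b) ^ 2 / 2 * Real.exp a := by positivity
    linarith

lemma sub_mul_exp_le (a b : ℝ) : (a - b) * Real.exp b ≤ (a - b) * Real.exp a := by
  rcases le_total a b with h | h
  · exact mul_le_mul_of_nonpos_left (Real.exp_le_exp.2 h) (by linarith)
  · exact mul_le_mul_of_nonneg_left (Real.exp_le_exp.2 h) (by linarith)

/-- The traces occurring in the second-order expansion of `B ↦ tr e^B` around `A`, expressed in
terms of the eigenvalues `a`, `b` of `A`, `B` and the squared overlaps `q` of their eigenvectors. -/
lemma exists_trace_overlap {A B : Matrix m m ℝ} (hA : A.IsHermitian) (hB : B.IsHermitian) :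
    ∃ (a b : m → ℝ) (q : m → m → ℝ), (∀ i j, 0 ≤ q i j) ∧
      trace (NormedSpace.exp A) = ∑ i, ∑ j, q i j * Real.exp (a i) ∧
      trace (NormedSpace.exp B) = ∑ i, ∑ j, q i j * Real.exp (b j) ∧
      trace ((A - B) * NormedSpace.exp A) = ∑ i, ∑ j, q i j * ((a i - b j) * Real.exp (a i)) ∧
      trace ((A - B) * NormedSpace.exp B) = ∑ i, ∑ j, q i j * ((a i - b j) * Real.exp (b j)) ∧
      trace ((A - B) * (A - B) * NormedSpace.exp A) =
        ∑ i, ∑ j, q i j * ((a i - b j) ^ 2 * Real.exp (a i)) ∧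
      trace ((A - B) * (A - B) * NormedSpace.exp B) =
        ∑ i, ∑ j, q i j * ((a i - b j) ^ 2 * Real.exp (b j)) := by
  obtain ⟨U, a, hU, hU', hA', hAe⟩ := exists_spectral hA
  obtain ⟨V, b, hV, hV', hB', hBe⟩ := exists_spectral hB
  have key : ∀ f g : m → ℝ, trace (U * diagonal f * Uᵀ * (V * diagonal g * Vᵀ)) =
      ∑ i, ∑ j, f i * g j * (Uᵀ * V) i j ^ 2 := trace_conj_mul_conj U V
  have mulU : ∀ f g : m → ℝ, U * diagonal f * Uᵀ * (U * diagonal g * Uᵀ) =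
      U * diagonal (fun i => f i * g i) * Uᵀ := fun f g => by
    rw [← diagonal_mul_diagonal, show U * diagonal f * Uᵀ * (U * diagonal g * Uᵀ) =
      U * diagonal f * (Uᵀ * U) * (diagonal g * Uᵀ) by simp only [Matrix.mul_assoc], hU,
      Matrix.mul_one]
    simp only [Matrix.mul_assoc]
  have mulV : ∀ f g : m → ℝ, V * diagonal f * Vᵀ * (V * diagonal g * Vᵀ) =
      V * diagonal (fun i => f i * g i) * Vᵀ := fun f g => by
    rw [← diagonal_mul_diagonal, show V * diagonal f * Vᵀ * (V * diagonal g * Vᵀ) =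
      V * diagonal f * (Vᵀ * V) * (diagonal g * Vᵀ) by simp only [Matrix.mul_assoc], hV,
      Matrix.mul_one]
    simp only [Matrix.mul_assoc]
  have oneU : U * diagonal (fun _ => (1 : ℝ)) * Uᵀ = 1 := by
    rw [diagonal_one, Matrix.mul_one, hU']
  have oneV : V * diagonal (fun _ => (1 : ℝ)) * Vᵀ = 1 := by
    rw [diagonal_one, Matrix.mul_one, hV']
  -- every mixed trace is a sum over pairs of eigenvalues
  have tA : ∀ f : m → ℝ, trace (U * diagonal f * Uᵀ) = ∑ i, ∑ j, f i * 1 * (Uᵀ * V) i j ^ 2 :=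
    fun f => by rw [← key, oneV, Matrix.mul_one]
  have tB : ∀ g : m → ℝ, trace (V * diagonal g * Vᵀ) = ∑ i, ∑ j, 1 * g j * (Uᵀ * V) i j ^ 2 :=
    fun g => by rw [← key (fun _ => 1), oneU, Matrix.one_mul]
  refine ⟨a, b, fun i j => (Uᵀ * V) i j ^ 2, fun i j => sq_nonneg _, ?_, ?_, ?_, ?_, ?_, ?_⟩
  · rw [hAe, tA]
    exact Finset.sum_congr rfl fun i _ => Finset.sum_congr rfl fun j _ => by ring
  · rw [hBe, tB]
    exact Finset.sum_congr rfl fun i _ => Finset.sum_congr rfl fun j _ => by ring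
  · rw [Matrix.sub_mul, trace_sub, Matrix.trace_mul_comm B, hAe, hA', hB', mulU, tA, key,
      ← Finset.sum_sub_distrib]
    refine Finset.sum_congr rfl fun i _ => ?_
    rw [← Finset.sum_sub_distrib]
    exact Finset.sum_congr rfl fun j _ => by ring
  · rw [Matrix.sub_mul, trace_sub, hBe, hA', hB', mulV, tB, key, ← Finset.sum_sub_distrib]
    refine Finset.sum_congr rfl fun i _ => ?_
    rw [← Finset.sum_sub_distrib]
    exact Finset.sum_congr rfl fun j _ => by ring
  · have : trace ((A - B) * (A - B) * NormedSpace.exp A) =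
        trace (A * (A * NormedSpace.exp A)) - trace (NormedSpace.exp A * A * B)
          - trace (A * NormedSpace.exp A * B) + trace (NormedSpace.exp A * (B * B)) := by
      simp only [Matrix.sub_mul, Matrix.mul_sub, trace_sub]
      rw [Matrix.trace_mul_comm (A * B), Matrix.trace_mul_comm (B * B),
        Matrix.mul_assoc B A, Matrix.trace_mul_comm B, Matrix.mul_assoc A A,
        Matrix.mul_assoc (NormedSpace.exp A) A B]
      ring
    rw [this, hAe, hA', hB', mulU, mulU, mulU, mulV, tA, key, key, key, ← Finset.sum_sub_distrib,
      ← Finset.sum_sub_distrib, ← Finset.sum_add_distrib]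
    refine Finset.sum_congr rfl fun i _ => ?_
    rw [← Finset.sum_sub_distrib, ← Finset.sum_sub_distrib, ← Finset.sum_add_distrib]
    exact Finset.sum_congr rfl fun j _ => by ring
  · have : trace ((A - B) * (A - B) * NormedSpace.exp B) =
        trace (A * A * NormedSpace.exp B) - trace (A * (B * NormedSpace.exp B))
          - trace (A * (NormedSpace.exp B * B)) + trace (B * (B * NormedSpace.exp B)) := by
      simp only [Matrix.sub_mul, Matrix.mul_sub, trace_sub]
      rw [Matrix.mul_assoc B A, Matrix.trace_mul_comm B, Matrix.mul_assoc A B,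
        Matrix.mul_assoc B B, Matrix.mul_assoc A (NormedSpace.exp B) B]
      ring
    rw [this, hBe, hA', hB', mulV, mulV, mulV, mulU, tB, key, key, key, ← Finset.sum_sub_distrib,
      ← Finset.sum_sub_distrib, ← Finset.sum_add_distrib]
    refine Finset.sum_congr rfl fun i _ => ?_
    rw [← Finset.sum_sub_distrib, ← Finset.sum_sub_distrib, ← Finset.sum_add_distrib]
    exact Finset.sum_congr rfl fun j _ => by ring

/-- `D ↦ tr (D e^{A - D})` does not exceed its first-order value `tr (D e^A)`. -/
lemma trace_mul_exp_sub_le {A D : Matrix m m ℝ} (hA : A.IsHermitian) (hD : D.IsHermitian) :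
    trace (D * NormedSpace.exp (A - D)) ≤ trace (D * NormedSpace.exp A) := by
  obtain ⟨a, b, q, hq, -, -, h1, h2, -, -⟩ := exists_trace_overlap hA (hA.sub hD)
  rw [sub_sub_cancel] at h1 h2
  rw [h1, h2]
  exact Finset.sum_le_sum fun i _ => Finset.sum_le_sum fun j _ =>
    mul_le_mul_of_nonneg_left (sub_mul_exp_le _ _) (hq i j)

/-- A one-sided second-order estimate for the trace exponential; it takes the place of the
Golden–Thompson inequality. -/
lemma trace_exp_sub_le {A D : Matrix m m ℝ} {ρ : ℝ} (hρ : 0 < ρ) (hA : A.IsHermitian)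
    (hD : D.PosSemidef) (hDρ : (ρ • (1 : Matrix m m ℝ) - D).PosSemidef) :
    trace (NormedSpace.exp (A - D)) ≤
      trace (NormedSpace.exp A) - (1 - ρ) * trace (D * NormedSpace.exp A) := by
  have hsq : ∀ {M : Matrix m m ℝ}, M.IsHermitian →
      trace (D * D * NormedSpace.exp M) ≤ ρ * trace (D * NormedSpace.exp M) := fun hM => by
    have := trace_mul_nonneg (posSemidef_smul_sub_sq hρ hD hDρ) (exp_posSemidef hM)
    rw [Matrix.sub_mul, trace_sub, Matrix.smul_mul, trace_smul, smul_eq_mul] at this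
    linarith
  have hsqA := hsq hA
  have hsqB := hsq (hA.sub hD.1)
  -- The quadratic terms at `A` and at `A - D` are both at most `ρ tr(D e^A)`, the second one by
  -- monotonicity, so their average costs exactly `ρ tr(D e^A)`.
  have hmono := mul_le_mul_of_nonneg_left (trace_mul_exp_sub_le hA hD.1) hρ.le
  obtain ⟨a, b, q, hq, h0, h0', h1, -, h3, h4⟩ := exists_trace_overlap hA (hA.sub hD.1)
  rw [sub_sub_cancel] at h1 h3 h4
  have hmain : trace (NormedSpace.exp (A - D)) - trace (NormedSpace.exp A) +
      trace (D * NormedSpace.exp A) ≤ (trace (D * D * NormedSpace.exp A) +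
        trace (D * D * NormedSpace.exp (A - D))) / 2 := by
    rw [h0, h0', h1, h3, h4, ← Finset.sum_sub_distrib, ← Finset.sum_add_distrib,
      ← Finset.sum_add_distrib, Finset.sum_div]
    refine Finset.sum_le_sum fun i _ => ?_
    rw [← Finset.sum_sub_distrib, ← Finset.sum_add_distrib, ← Finset.sum_add_distrib,
      Finset.sum_div]
    refine Finset.sum_le_sum fun j _ => ?_
    have := mul_le_mul_of_nonneg_left (exp_sub_exp_add_le (a i) (b j)) (hq i j)
    linarith
  linarith

/-- Jensen's inequality for the quadratic form of the matrix exponential. -/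
lemma exp_dotProduct_le {A : Matrix m m ℝ} (hA : A.IsHermitian) {x : m → ℝ} (hx : x ⬝ᵥ x = 1) :
    Real.exp (x ⬝ᵥ A *ᵥ x) ≤ x ⬝ᵥ NormedSpace.exp A *ᵥ x := by
  obtain ⟨U, a, -, hU, hA', hAe⟩ := exists_spectral hA
  have key : ∀ f : m → ℝ, x ⬝ᵥ (U * diagonal f * Uᵀ) *ᵥ x = ∑ i, (Uᵀ *ᵥ x) i ^ 2 * f i := by
    intro f
    rw [Matrix.mul_assoc, ← mulVec_mulVec, dotProduct_mulVec, ← mulVec_transpose, ← mulVec_mulVec]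
    simp only [dotProduct, mulVec_diagonal]
    exact Finset.sum_congr rfl fun i _ => by ring
  have h1 : ∑ i, (Uᵀ *ᵥ x) i ^ 2 = 1 := by
    have := key fun _ => 1
    rw [diagonal_one, Matrix.mul_one, hU, one_mulVec, hx] at this
    simpa using this.symm
  rw [hAe, key, hA', key]
  have := convexOn_exp.map_sum_le (t := Finset.univ) (w := fun i => (Uᵀ *ᵥ x) i ^ 2) (p := a)
    (fun i _ => sq_nonneg _) h1 (fun _ _ => Set.mem_univ _)
  simpa [smul_eq_mul] using this

end MatrixExponential

/-! ### Weighted Laplacians, the projector `Π` and the set `Δ`. -/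

section Laplacian

open Matrix

variable {n : ℕ}

/-- Each non-loop comes from two ordered pairs, while a loop comes from only one; hence the
hypothesis that loops contribute nothing. -/
lemma sum_sum_sym2 {f : Sym2 (Fin n) → ℝ} (hf : ∀ i, f s(i, i) = 0) :
    ∑ i, ∑ j, f s(i, j) = 2 * ∑ e, f e := by
  classical
  rw [← Fintype.sum_prod_type', Finset.mul_sum,
    ← Finset.sum_fiberwise (s := Finset.univ) (g := fun x : Fin n × Fin n => s(x.1, x.2))]
  refine Finset.sum_congr rfl fun e _ => ?_
  induction e with | _ a b => ?_
  rw [Finset.sum_congr rfl (g := fun _ => f s(a, b))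
    (fun x hx => by rw [(Finset.mem_filter.1 hx).2]), Finset.sum_const, nsmul_eq_mul]
  by_cases hab : a = b
  · subst hab
    simp [hf]
  · have : (Finset.univ.filter fun x : Fin n × Fin n => s(x.1, x.2) = s(a, b)) =
        {(a, b), (b, a)} := by
      ext ⟨x, y⟩
      simp
    rw [this, Finset.card_pair (by simp [hab])]
    norm_num

/-- The squared difference of the values of `x` at the endpoints of an edge. -/
noncomputable def sqDiff (x : Fin n → ℝ) (e : Sym2 (Fin n)) : ℝ :=
  Sym2.lift ⟨fun i j => (x i - x j) ^ 2, fun i j => by ring⟩ e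

@[simp] lemma sqDiff_mk (x : Fin n → ℝ) (i j : Fin n) : sqDiff x s(i, j) = (x i - x j) ^ 2 := rfl

lemma sqDiff_nonneg (x : Fin n → ℝ) (e : Sym2 (Fin n)) : 0 ≤ sqDiff x e := by
  induction e with | _ i j => exact sq_nonneg _

lemma edgeLap_mk (i j : Fin n) : edgeLap s(i, j) =
    vecMulVec (Pi.single i (1 : ℝ) - Pi.single j 1) (Pi.single i (1 : ℝ) - Pi.single j 1) := rfl

@[simp] lemma edgeLap_diag (i : Fin n) : edgeLap s(i, i) = 0 := by
  rw [edgeLap_mk, sub_self, zero_vecMulVec]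

lemma edgeLap_posSemidef (e : Sym2 (Fin n)) : (edgeLap e).PosSemidef := by
  induction e with | _ i j => ?_
  rw [edgeLap_mk]
  have := posSemidef_vecMulVec_self_star (Pi.single i (1 : ℝ) - Pi.single j 1 : Fin n → ℝ)
  simpa using this

lemma dotProduct_edgeLap_mulVec (x : Fin n → ℝ) (e : Sym2 (Fin n)) :
    x ⬝ᵥ edgeLap e *ᵥ x = sqDiff x e := by
  induction e with | _ i j => ?_
  rw [edgeLap_mk, vecMulVec_mulVec, sqDiff_mk]
  simp [dotProduct_sub, sub_dotProduct, sq, mul_comm]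

lemma dotProduct_lap_mulVec (w : Weights n) (x : Fin n → ℝ) :
    x ⬝ᵥ lap w *ᵥ x = ∑ e, w e * sqDiff x e := by
  simp only [lap, sum_mulVec, dotProduct_sum, smul_mulVec, dotProduct_smul,
    dotProduct_edgeLap_mulVec, smul_eq_mul]

lemma lap_isHermitian (w : Weights n) : (lap w).IsHermitian := by
  unfold lap IsHermitian
  rw [conjTranspose_sum]
  refine Finset.sum_congr rfl fun e _ => ?_
  rw [conjTranspose_smul, (edgeLap_posSemidef e).1.eq, star_trivial]

lemma lap_posSemidef {w : Weights n} (hw : ∀ e, 0 ≤ w e) : (lap w).PosSemidef := by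
  refine PosSemidef.of_dotProduct_mulVec_nonneg (lap_isHermitian w) fun x => ?_
  rw [star_trivial, dotProduct_lap_mulVec]
  exact Finset.sum_nonneg fun e _ => mul_nonneg (hw e) (sqDiff_nonneg x e)

lemma lap_add (w w' : Weights n) : lap (w + w') = lap w + lap w' := by
  simp [lap, add_smul, Finset.sum_add_distrib]

lemma lap_smul (r : ℝ) (w : Weights n) : lap (r • w) = r • lap w := by
  simp [lap, Finset.smul_sum, smul_smul]

@[simp] lemma lap_zero : lap (0 : Weights n) = 0 := by simp [lap]

lemma lap_mulVec_one (w : Weights n) : lap w *ᵥ (1 : Fin n → ℝ) = 0 := by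
  simp only [lap, sum_mulVec, smul_mulVec]
  refine Finset.sum_eq_zero fun e _ => ?_
  induction e with | _ i j => ?_
  rw [edgeLap_mk, vecMulVec_mulVec]
  simp [sub_dotProduct]

lemma sum_mul_sqDiff_le {w : Weights n} (hw : ∀ e, 0 ≤ w e) (x : Fin n → ℝ) :
    ∑ e, w e * sqDiff x e ≤ 2 * ∑ i, wdeg w i * x i ^ 2 := by
  have h := sum_sum_sym2 (f := fun e => w e * sqDiff x e) (by simp)
  have h1 : ∑ i, ∑ j, w s(i, j) * (x i - x j) ^ 2 ≤
      ∑ i, ∑ j, (2 * (w s(i, j) * x i ^ 2) + 2 * (w s(i, j) * x j ^ 2)) :=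
    Finset.sum_le_sum fun i _ => Finset.sum_le_sum fun j _ => by
      have := mul_le_mul_of_nonneg_left (show (x i - x j) ^ 2 ≤ 2 * x i ^ 2 + 2 * x j ^ 2 by
        nlinarith [sq_nonneg (x i + x j)]) (hw s(i, j))
      linarith
  have h2 : ∑ i, ∑ j, w s(i, j) * x i ^ 2 = ∑ i, wdeg w i * x i ^ 2 :=
    Finset.sum_congr rfl fun i _ => by rw [wdeg, Finset.sum_mul]
  have h3 : ∑ i, ∑ j, w s(i, j) * x j ^ 2 = ∑ i, wdeg w i * x i ^ 2 := by
    rw [Finset.sum_comm, ← h2]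
    exact Finset.sum_congr rfl fun i _ => Finset.sum_congr rfl fun j _ => by rw [Sym2.eq_swap]
  simp only [Finset.sum_add_distrib, ← Finset.mul_sum, h2, h3] at h1
  simp only [sqDiff_mk] at h
  linarith

/-- The bound `(x_i - x_j)² ≤ 2x_i² + 2x_j²` gives `L_w ≼ 2 max deg`. It supplies the width `ρ`
needed in `trace_exp_sub_le`. -/
lemma smul_one_sub_lap_posSemidef {w : Weights n} {b : ℝ} (hw : ∀ e, 0 ≤ w e)
    (hb : ∀ i, wdeg w i ≤ b) : ((2 * b) • (1 : Matrix (Fin n) (Fin n) ℝ) - lap w).PosSemidef := by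
  refine PosSemidef.of_dotProduct_mulVec_nonneg ?_ fun x => ?_
  · refine IsHermitian.sub ?_ (lap_isHermitian w)
    simp [IsHermitian]
  · rw [star_trivial, sub_mulVec, dotProduct_sub, dotProduct_lap_mulVec, smul_mulVec,
      one_mulVec, dotProduct_smul, smul_eq_mul, sub_nonneg]
    refine (sum_mul_sqDiff_le hw x).trans ?_
    rw [mul_assoc, dotProduct, Finset.mul_sum Finset.univ _ b]
    refine mul_le_mul_of_nonneg_left (Finset.sum_le_sum fun i _ => ?_) (zero_le_two (α := ℝ))
    rw [sq]
    exact mul_le_mul_of_nonneg_right (hb i) (mul_self_nonneg _)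

lemma matInner_eq_trace {A B : Matrix (Fin n) (Fin n) ℝ} (hB : B.IsHermitian) :
    matInner A B = trace (A * B) := by
  simp only [matInner, trace, diag_apply, Matrix.mul_apply]
  refine Finset.sum_congr rfl fun i _ => Finset.sum_congr rfl fun j _ => ?_
  rw [← hB.apply i j, star_trivial]

lemma matInner_smul_right (r : ℝ) (A B : Matrix (Fin n) (Fin n) ℝ) :
    matInner A (r • B) = r * matInner A B := by
  simp only [matInner, Finset.mul_sum, Matrix.smul_apply, smul_eq_mul]
  exact Finset.sum_congr rfl fun i _ => Finset.sum_congr rfl fun j _ => by ring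

lemma matInner_lap (w : Weights n) (B : Matrix (Fin n) (Fin n) ℝ) :
    matInner (lap w) B = ∑ e, w e * matInner (edgeLap e) B := by
  simp only [matInner, lap, Matrix.sum_apply, Matrix.smul_apply, smul_eq_mul, Finset.sum_mul, Finset.mul_sum]
  rw [Finset.sum_congr rfl fun i _ => Finset.sum_comm, Finset.sum_comm]
  exact Finset.sum_congr rfl fun e _ => Finset.sum_congr rfl fun i _ =>
    Finset.sum_congr rfl fun j _ => by ring

lemma matInner_nonneg {A B : Matrix (Fin n) (Fin n) ℝ} (hA : A.PosSemidef) (hB : B.PosSemidef) :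
    0 ≤ matInner A B := by
  rw [matInner_eq_trace hB.1]
  exact trace_mul_nonneg hA hB

lemma projPerpOnes_isHermitian : (projPerpOnes n).IsHermitian := by
  unfold projPerpOnes
  refine IsHermitian.sub isHermitian_one ?_
  ext i j
  simp

/-- The deviation of `x` from its mean. -/
noncomputable def center (x : Fin n → ℝ) : Fin n → ℝ := fun i => x i - (∑ j, x j) / n

lemma sum_center (x : Fin n → ℝ) : ∑ i, center x i = 0 := by
  rcases n.eq_zero_or_pos with rfl | hn
  · simp
  · have : (n : ℝ) ≠ 0 := by positivity
    simp [center, Finset.sum_sub_distrib]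
    field_simp
    simp

lemma sqDiff_center (x : Fin n → ℝ) (e : Sym2 (Fin n)) : sqDiff (center x) e = sqDiff x e := by
  induction e with | _ i j => simp [center]

lemma dotProduct_projPerpOnes_mulVec (x : Fin n → ℝ) :
    x ⬝ᵥ projPerpOnes n *ᵥ x = center x ⬝ᵥ center x := by
  have h1 : projPerpOnes n *ᵥ x = center x := by
    ext i
    simp only [projPerpOnes, sub_mulVec, one_mulVec, Pi.sub_apply, center]
    simp [mulVec, dotProduct, Finset.mul_sum, div_eq_inv_mul]
  have h2 : ∀ i, x i = center x i + (∑ j, x j) / n := fun i => by simp [center]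
  rw [h1, dotProduct, Finset.sum_congr rfl fun i _ => by rw [h2 i, add_mul]]
  rw [Finset.sum_add_distrib, ← Finset.mul_sum, sum_center, mul_zero, add_zero, dotProduct]

lemma projPerpOnes_posSemidef : (projPerpOnes n).PosSemidef := by
  refine PosSemidef.of_dotProduct_mulVec_nonneg projPerpOnes_isHermitian fun x => ?_
  rw [star_trivial, dotProduct_projPerpOnes_mulVec]
  exact Finset.sum_nonneg fun i _ => mul_self_nonneg _

/-- The unweighted edge Laplacians of the complete graph sum to `n Π`. -/
lemma lap_one (hn : n ≠ 0) : lap (1 : Weights n) = (n : ℝ) • projPerpOnes n := by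
  ext a b
  have h := sum_sum_sym2 (f := fun e => edgeLap e a b) (by simp)
  have h1 : lap (1 : Weights n) a b = ∑ e, edgeLap e a b := by simp [lap, Matrix.sum_apply]
  have hn' : (n : ℝ) ≠ 0 := by positivity
  rw [h1, ← mul_right_inj' (two_ne_zero' ℝ), ← h]
  simp only [edgeLap_mk, vecMulVec_apply, Pi.sub_apply, Pi.single_apply, projPerpOnes, Matrix.smul_apply,
    Matrix.sub_apply, of_apply, smul_eq_mul, one_apply, sub_mul, mul_sub, Finset.sum_sub_distrib]
  by_cases hab : a = b
  · subst hab
    simp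
    field_simp
    ring
  · simp [hab]
    field_simp
    norm_num

lemma exp_mulVec_of_mulVec_eq_zero {A : Matrix (Fin n) (Fin n) ℝ} (hA : A.IsHermitian)
    {v : Fin n → ℝ} (hv : A *ᵥ v = 0) : NormedSpace.exp A *ᵥ v = v := by
  obtain ⟨U, a, hU, hU', hA', hAe⟩ := exists_spectral hA
  have h1 : diagonal a *ᵥ (Uᵀ *ᵥ v) = 0 := by
    have := congrArg (fun z => Uᵀ *ᵥ z) hv
    simpa [hA', ← Matrix.mul_assoc, hU] using this
  have h2 : diagonal (fun i => Real.exp (a i)) *ᵥ (Uᵀ *ᵥ v) = Uᵀ *ᵥ v := by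
    ext i
    have := congrFun h1 i
    rw [mulVec_diagonal, Pi.zero_apply, mul_eq_zero] at this
    rw [mulVec_diagonal]
    rcases this with h | h <;> simp [h]
  rw [hAe, Matrix.mul_assoc, ← mulVec_mulVec, ← mulVec_mulVec, h2, mulVec_mulVec, hU', one_mulVec]

lemma matInner_projPerpOnes (hn : n ≠ 0) {B : Matrix (Fin n) (Fin n) ℝ}
    (hB : B *ᵥ (1 : Fin n → ℝ) = 1) : matInner (projPerpOnes n) B = trace B - 1 := by
  have hn' : (n : ℝ) ≠ 0 := by positivity
  have h1 : ∀ i, ∑ j, B i j = 1 := fun i => by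
    simpa [mulVec, dotProduct] using congrFun hB i
  simp only [matInner, projPerpOnes, Matrix.sub_apply, of_apply, sub_mul, Finset.sum_sub_distrib,
    ← Finset.mul_sum, h1, one_apply, ite_mul, one_mul, zero_mul, Finset.sum_ite_eq,
    Finset.mem_univ, if_true, trace, diag_apply]
  simp [hn']

/-! ### The exponential potential and its relation to the objective. -/

lemma neg_smul_lap_isHermitian (s : ℝ) (w : Weights n) : (-s • lap w).IsHermitian := by
  have := lap_isHermitian ((-s) • w)
  rwa [lap_smul] at this

/-- The potential `⟨Π, exp(-s L_w)⟩`. -/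
noncomputable def potential (s : ℝ) (w : Weights n) : ℝ :=
  matInner (projPerpOnes n) (NormedSpace.exp (-s • lap w))

/-- The all-ones vector is in the kernel of `L_w`, so it is an eigenvector of the exponential with
eigenvalue `1`, and `Π` removes exactly this eigenvalue. Estimates for the full trace therefore
transfer to the potential. -/
lemma potential_eq_trace (hn : n ≠ 0) (s : ℝ) (w : Weights n) :
    potential s w = trace (NormedSpace.exp (-s • lap w)) - 1 := by
  refine matInner_projPerpOnes hn
    (exp_mulVec_of_mulVec_eq_zero (neg_smul_lap_isHermitian s w) ?_)
  rw [smul_mulVec, lap_mulVec_one, smul_zero]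

lemma potential_zero_weights (hn : n ≠ 0) (s : ℝ) : potential s (0 : Weights n) = n - 1 := by
  rw [potential_eq_trace hn]
  simp

/-- Jensen's inequality bounds the left side by `⟨xxᵀ, e^A⟩`, and `xxᵀ ≼ Π` by Cauchy–Schwarz
because `x` is a unit vector orthogonal to the all-ones vector. -/
lemma exp_dotProduct_le_matInner {A : Matrix (Fin n) (Fin n) ℝ} (hA : A.IsHermitian)
    {x : Fin n → ℝ} (hx : x ⬝ᵥ x = 1) (hx0 : ∑ i, x i = 0) :
    Real.exp (x ⬝ᵥ A *ᵥ x) ≤ matInner (projPerpOnes n) (NormedSpace.exp A) := by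
  refine (exp_dotProduct_le hA hx).trans ?_
  have hpsd : (projPerpOnes n - vecMulVec x x).PosSemidef := by
    have hx1 : (vecMulVec x x).IsHermitian := by
      simpa using (posSemidef_vecMulVec_self_star x).1
    refine PosSemidef.of_dotProduct_mulVec_nonneg (projPerpOnes_isHermitian.sub hx1) fun y => ?_
    rw [star_trivial, sub_mulVec, dotProduct_sub, dotProduct_projPerpOnes_mulVec,
      vecMulVec_mulVec, sub_nonneg]
    have h1 : x ⬝ᵥ y = x ⬝ᵥ center y := by
      simp only [dotProduct, center, mul_sub, Finset.sum_sub_distrib, ← Finset.sum_mul, hx0]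
      simp
    have h2 := Finset.sum_mul_sq_le_sq_mul_sq Finset.univ x (center y)
    have h3 : ∑ i, x i ^ 2 = 1 := by simpa [dotProduct, sq] using hx
    rw [h3, one_mul] at h2
    have h4 : y ⬝ᵥ (MulOpposite.op (x ⬝ᵥ y) • x) = (x ⬝ᵥ center y) ^ 2 := by
      rw [← h1, dotProduct_smul, dotProduct_comm y x, sq]
      simp
    rw [h4]
    simpa [dotProduct, sq] using h2
  have h := trace_mul_nonneg hpsd (exp_posSemidef hA)
  rw [Matrix.sub_mul, trace_sub, sub_nonneg, vecMulVec_mul, trace_vecMulVec,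
    ← mulVec_transpose, ← conjTranspose_eq_transpose_of_trivial, (exp_posSemidef hA).1.eq] at h
  rwa [matInner_eq_trace (exp_posSemidef hA).1]

lemma exists_unit_sum_eq_zero (hn : 2 ≤ n) : ∃ x : Fin n → ℝ, x ⬝ᵥ x = 1 ∧ ∑ i, x i = 0 := by
  obtain ⟨m, rfl⟩ := Nat.exists_eq_add_of_le' hn
  refine ⟨(√2)⁻¹ • (Pi.single 0 1 - Pi.single 1 1), ?_, ?_⟩
  · have h : (√2 : ℝ) * √2 = 2 := Real.mul_self_sqrt zero_le_two
    have h0 : (√2 : ℝ) ≠ 0 := by positivity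
    simp only [dotProduct_smul, smul_dotProduct, smul_eq_mul, sub_dotProduct, dotProduct_sub,
      single_one_dotProduct]
    simp
    field_simp
    nlinarith
  · simp [← Finset.mul_sum, Finset.sum_sub_distrib]

lemma matInner_projPerpOnes_exp_pos (hn : 2 ≤ n) {A : Matrix (Fin n) (Fin n) ℝ}
    (hA : A.IsHermitian) : 0 < matInner (projPerpOnes n) (NormedSpace.exp A) := by
  obtain ⟨x, hx, hx0⟩ := exists_unit_sum_eq_zero hn
  exact (Real.exp_pos _).trans_le (exp_dotProduct_le_matInner hA hx hx0)

lemma potential_pos (hn : 2 ≤ n) (s : ℝ) (w : Weights n) : 0 < potential s w :=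
  matInner_projPerpOnes_exp_pos hn (neg_smul_lap_isHermitian s w)

lemma exp_smul_mem_specSet (hn : 2 ≤ n) {A : Matrix (Fin n) (Fin n) ℝ} (hA : A.IsHermitian) :
    (matInner (projPerpOnes n) (NormedSpace.exp A))⁻¹ • NormedSpace.exp A ∈ specSet n := by
  have h := matInner_projPerpOnes_exp_pos hn hA
  exact ⟨(exp_posSemidef hA).smul (inv_nonneg.2 h.le), by
    rw [matInner_smul_right, inv_mul_cancel₀ h.ne']⟩

lemma specSet_nonempty (hn : 2 ≤ n) : (specSet n).Nonempty :=
  ⟨_, exp_smul_mem_specSet hn isHermitian_zero⟩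

lemma objective_le {w : Weights n} (hw : ∀ e, 0 ≤ w e) {X : Matrix (Fin n) (Fin n) ℝ}
    (hX : X ∈ specSet n) : objective w ≤ matInner (lap w) X := by
  refine csInf_le ⟨0, ?_⟩ ⟨X, hX, rfl⟩
  rintro _ ⟨Y, hY, rfl⟩
  exact matInner_nonneg (lap_posSemidef hw) hY.1

lemma objective_nonneg {w : Weights n} (hw : ∀ e, 0 ≤ w e) : 0 ≤ objective w := by
  refine Real.sInf_nonneg ?_
  rintro _ ⟨Y, hY, rfl⟩
  exact matInner_nonneg (lap_posSemidef hw) hY.1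

/-- A lower bound for the Rayleigh quotients of `L_w` on `1^⊥` is a lower bound for the
objective. -/
lemma le_objective (hn : 2 ≤ n) {w : Weights n} {r : ℝ}
    (h : ∀ x : Fin n → ℝ, x ⬝ᵥ x = 1 → ∑ i, x i = 0 → r ≤ x ⬝ᵥ lap w *ᵥ x) :
    r ≤ objective w := by
  -- By homogeneity and invariance under constants, the hypothesis on unit vectors says `L_w ≽ rΠ`.
  -- Pairing this with `X ∈ Δ` gives the bound.
  have hpsd : (lap w - r • projPerpOnes n).PosSemidef := by
    refine PosSemidef.of_dotProduct_mulVec_nonneg ((lap_isHermitian w).sub ?_) fun y => ?_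
    · rw [IsHermitian, conjTranspose_smul, projPerpOnes_isHermitian.eq, star_trivial]
    rw [star_trivial, sub_mulVec, dotProduct_sub, smul_mulVec, dotProduct_smul,
      dotProduct_projPerpOnes_mulVec, smul_eq_mul, sub_nonneg]
    have hy : y ⬝ᵥ lap w *ᵥ y = center y ⬝ᵥ lap w *ᵥ center y := by
      simp only [dotProduct_lap_mulVec, sqDiff_center]
    rw [hy]
    set z := center y with hz
    by_cases hz0 : z = 0
    · simp [hz0]
    have hzz : 0 < z ⬝ᵥ z := by
      have := dotProduct_self_star_pos_iff.2 hz0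
      simpa using this
    set s := √(z ⬝ᵥ z) with hs
    have hs0 : s ≠ 0 := (Real.sqrt_pos.2 hzz).ne'
    have hss : s * s = z ⬝ᵥ z := Real.mul_self_sqrt hzz.le
    have h1 := h (s⁻¹ • z) (by
      rw [dotProduct_smul, smul_dotProduct, smul_eq_mul, smul_eq_mul, ← hss]
      field_simp) (by
      simp only [Pi.smul_apply, smul_eq_mul, ← Finset.mul_sum]
      rw [hz, sum_center, mul_zero])
    rw [mulVec_smul, dotProduct_smul, smul_dotProduct, smul_eq_mul, smul_eq_mul, ← mul_assoc,
      ← mul_inv, hss, inv_mul_eq_div, le_div_iff₀ hzz] at h1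
    exact h1
  refine le_csInf ((specSet_nonempty hn).image _) ?_
  rintro _ ⟨X, hX, rfl⟩
  have h1 := trace_mul_nonneg hpsd hX.1
  rw [Matrix.sub_mul, Matrix.smul_mul, trace_sub, trace_smul, ← matInner_eq_trace hX.1.1,
    ← matInner_eq_trace hX.1.1, hX.2] at h1
  simpa using h1

/-- A bound on the potential bounds the objective from below. -/
lemma neg_log_potential_le (hn : 2 ≤ n) {s : ℝ} (hs : 0 < s) (w : Weights n) :
    -Real.log (potential s w) ≤ s * objective w := by
  rw [← div_le_iff₀' hs]
  refine le_objective hn fun x hx hx0 => ?_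
  have h : _ ≤ potential s w :=
    exp_dotProduct_le_matInner (neg_smul_lap_isHermitian s w) hx hx0
  rw [← Real.le_log_iff_exp_le (potential_pos hn s w), smul_mulVec, dotProduct_smul,
    smul_eq_mul] at h
  rw [div_le_iff₀' hs]
  linarith

/-- Decrease of the potential when the weights `v` are added to `w`. -/
lemma potential_add_le (hn : n ≠ 0) {s b : ℝ} (hs : 0 < s) (hb : 0 < b) (w : Weights n)
    {v : Weights n} (hv : ∀ e, 0 ≤ v e) (hvb : ∀ i, wdeg v i ≤ b) :
    potential s (w + v) ≤ potential s w -
      (1 - 2 * b * s) * (s * matInner (lap v) (NormedSpace.exp (-s • lap w))) := by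
  have hA := neg_smul_lap_isHermitian s w
  have hD : (s • lap v).PosSemidef := (lap_posSemidef hv).smul hs.le
  have hDρ : ((2 * b * s) • (1 : Matrix (Fin n) (Fin n) ℝ) - s • lap v).PosSemidef := by
    have := (smul_one_sub_lap_posSemidef hv hvb).smul hs.le
    rwa [smul_sub, smul_smul, mul_comm s] at this
  have h := trace_exp_sub_le (by positivity) hA hD hDρ
  rw [potential_eq_trace hn, potential_eq_trace hn, matInner_eq_trace (exp_posSemidef hA).1,
    lap_add, smul_add, neg_smul s (lap v), ← sub_eq_add_neg]
  rw [Matrix.smul_mul, trace_smul, smul_eq_mul] at h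
  linarith

/-- In Russo's formula this allows the drop caused by an edge to be measured at the current edge
set, even if that set already contains the edge. -/
lemma matInner_lap_exp_add_le {s : ℝ} (w v : Weights n) (hs : 0 < s) :
    matInner (lap v) (NormedSpace.exp (-s • lap (w + v))) ≤
      matInner (lap v) (NormedSpace.exp (-s • lap w)) := by
  have hA := neg_smul_lap_isHermitian s w
  have hD : (s • lap v).IsHermitian := by
    have := neg_smul_lap_isHermitian (-s) v
    rwa [neg_neg] at this
  have h := trace_mul_exp_sub_le hA hD
  rw [matInner_eq_trace (exp_posSemidef hA).1, matInner_eq_trace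
    (exp_posSemidef (neg_smul_lap_isHermitian s _)).1, lap_add, smul_add, neg_smul s (lap v),
    ← sub_eq_add_neg]
  rw [Matrix.smul_mul, Matrix.smul_mul, trace_smul, trace_smul, smul_eq_mul, smul_eq_mul] at h
  exact le_of_mul_le_mul_left h hs

end Laplacian

/-! ### Expectations over random subsets and Russo's formula. -/

section BernoulliSubsets

variable {α : Type*}

/-- The expectation of `φ S`, where `S` is a random subset of `E` that contains each element
independently with probability `q`. -/
noncomputable def bernExp (E : Finset α) (q : ℝ) (φ : Finset α → ℝ) : ℝ :=
  ∑ S ∈ E.powerset, q ^ S.card * (1 - q) ^ (E.card - S.card) * φ S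

lemma bernExp_insert [DecidableEq α] {E : Finset α} {a : α} (ha : a ∉ E) (q : ℝ) (φ : Finset α → ℝ) :
    bernExp (insert a E) q φ =
      (1 - q) * bernExp E q φ + q * bernExp E q (fun S => φ (insert a S)) := by
  unfold bernExp
  rw [Finset.sum_powerset_insert ha, Finset.mul_sum, Finset.mul_sum]
  congr 1 <;> refine Finset.sum_congr rfl fun S hS => ?_
  · have := Finset.card_le_card (Finset.mem_powerset.1 hS)
    rw [Finset.card_insert_of_notMem ha, Nat.succ_sub this, pow_succ]
    ring
  · rw [Finset.card_insert_of_notMem ha,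
      Finset.card_insert_of_notMem fun h => ha (Finset.mem_powerset.1 hS h), Nat.add_sub_add_right,
      pow_succ]
    ring

lemma bernExp_congr {E : Finset α} {q : ℝ} {φ ψ : Finset α → ℝ} (h : ∀ S ⊆ E, φ S = ψ S) :
    bernExp E q φ = bernExp E q ψ :=
  Finset.sum_congr rfl fun S hS => by rw [h S (Finset.mem_powerset.1 hS)]

lemma bernExp_mono {E : Finset α} {q : ℝ} (hq0 : 0 ≤ q) (hq1 : q ≤ 1) {φ ψ : Finset α → ℝ}
    (h : ∀ S ⊆ E, φ S ≤ ψ S) : bernExp E q φ ≤ bernExp E q ψ :=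
  Finset.sum_le_sum fun S hS => mul_le_mul_of_nonneg_left (h S (Finset.mem_powerset.1 hS))
    (mul_nonneg (pow_nonneg hq0 _) (pow_nonneg (sub_nonneg.2 hq1) _))

lemma bernExp_sub (E : Finset α) (q : ℝ) (φ ψ : Finset α → ℝ) :
    bernExp E q (fun S => φ S - ψ S) = bernExp E q φ - bernExp E q ψ := by
  simp [bernExp, mul_sub, Finset.sum_sub_distrib]

lemma bernExp_const_mul (E : Finset α) (q c : ℝ) (φ : Finset α → ℝ) :
    bernExp E q (fun S => c * φ S) = c * bernExp E q φ := by
  unfold bernExp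
  rw [Finset.mul_sum]
  exact Finset.sum_congr rfl fun S _ => by ring

lemma bernExp_sum {ι : Type*} (s : Finset ι) (E : Finset α) (q : ℝ) (φ : ι → Finset α → ℝ) :
    bernExp E q (fun S => ∑ i ∈ s, φ i S) = ∑ i ∈ s, bernExp E q (φ i) := by
  unfold bernExp
  rw [Finset.sum_comm]
  exact Finset.sum_congr rfl fun S _ => by rw [Finset.mul_sum]

lemma bernExp_zero (E : Finset α) (φ : Finset α → ℝ) : bernExp E 0 φ = φ ∅ := by
  unfold bernExp
  rw [Finset.sum_eq_single ∅]
  · simp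
  · intro S _ hS
    rw [zero_pow (Finset.card_ne_zero.2 (Finset.nonempty_iff_ne_empty.2 hS))]
    ring
  · simp

/-- Russo's formula. -/
lemma hasDerivAt_bernExp [DecidableEq α] (E : Finset α) (φ : Finset α → ℝ) (q : ℝ) :
    HasDerivAt (fun q => bernExp E q φ)
      (∑ e ∈ E, bernExp E q fun S => φ (insert e S) - φ (S.erase e)) q := by
  induction E using Finset.induction_on generalizing φ with
  | empty => simpa [bernExp] using hasDerivAt_const q (φ ∅)
  | insert a E ha ih =>
    have h1 : HasDerivAt (fun q : ℝ => 1 - q) (-1) q := (hasDerivAt_id q).const_sub 1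
    have h2 := (h1.mul (ih φ)).add ((hasDerivAt_id q).mul (ih fun S => φ (insert a S)))
    have h3 : (fun q => bernExp (insert a E) q φ) = (fun q : ℝ => 1 - q) *
        (fun q => bernExp E q φ) + id * (fun q => bernExp E q fun S => φ (insert a S)) := by
      ext q
      simp [bernExp_insert ha]
    rw [h3]
    refine h2.congr_deriv ?_
    rw [Finset.sum_insert ha, bernExp_insert ha]
    -- Subsets of `E` do not contain `a`, so erasing `a` has no effect and the derivative coming
    -- from the new element is the difference of the two conditional expectations.
    have h4 : bernExp E q (fun S => φ (insert a S) - φ (S.erase a)) =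
        bernExp E q (fun S => φ (insert a S)) - bernExp E q φ := by
      rw [← bernExp_sub]
      exact bernExp_congr fun S hS => by rw [Finset.erase_eq_of_notMem fun h => ha (hS h)]
    have h5 : bernExp E q (fun S => φ (insert a (insert a S)) - φ ((insert a S).erase a)) =
        bernExp E q (fun S => φ (insert a S)) - bernExp E q φ := by
      rw [← bernExp_sub]
      exact bernExp_congr fun S hS => by
        rw [Finset.erase_insert fun h => ha (hS h), Finset.insert_idem]
    have h6 : ∀ e ∈ E, bernExp (insert a E) q (fun S => φ (insert e S) - φ (S.erase e)) =
        (1 - q) * bernExp E q (fun S => φ (insert e S) - φ (S.erase e)) +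
        q * bernExp E q (fun S => φ (insert a (insert e S)) - φ (insert a (S.erase e))) := by
      intro e he
      have hae : a ≠ e := fun h => ha (h ▸ he)
      rw [bernExp_insert ha]
      congr 2
      exact bernExp_congr fun S _ => by
        rw [Finset.insert_comm, Finset.erase_insert_of_ne hae]
    rw [h4, h5, Finset.sum_congr rfl h6, Finset.sum_add_distrib, ← Finset.mul_sum,
      ← Finset.mul_sum]
    simp only [id]
    ring

/-- A differential inequality for `bernExp` deduced from Russo's formula. -/
lemma bernExp_le_exp [DecidableEq α] {E : Finset α} {φ : Finset α → ℝ} {κ : ℝ}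
    (h : ∀ S ⊆ E, ∑ e ∈ E, (φ (insert e S) - φ (S.erase e)) ≤ κ * φ S) {p : ℝ} (hp0 : 0 ≤ p)
    (hp1 : p ≤ 1) : bernExp E p φ ≤ Real.exp (κ * p) * φ ∅ := by
  -- Grönwall's argument: the integrating factor `exp(-κq)` makes the expectation antitone on `[0,
  -- 1]`, and at `q = 0` the random set is empty.
  have hd : ∀ q, HasDerivAt (fun q => Real.exp (-(κ * q)) * bernExp E q φ)
      (Real.exp (-(κ * q)) * ((∑ e ∈ E, bernExp E q fun S => φ (insert e S) - φ (S.erase e)) -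
        κ * bernExp E q φ)) q := fun q => by
    have h1 : HasDerivAt (fun q => Real.exp (-(κ * q))) (Real.exp (-(κ * q)) * -(κ * 1)) q :=
      (((hasDerivAt_id q).const_mul κ).neg).exp
    exact (h1.mul (hasDerivAt_bernExp E φ q)).congr_deriv (by ring)
  have hanti : AntitoneOn (fun q => Real.exp (-(κ * q)) * bernExp E q φ) (Set.Icc 0 1) := by
    refine antitoneOn_of_deriv_nonpos (convex_Icc 0 1)
      (fun q _ => (hd q).continuousAt.continuousWithinAt)
      (fun q _ => (hd q).differentiableAt.differentiableWithinAt) fun q hq => ?_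
    rw [interior_Icc] at hq
    rw [(hd q).deriv, ← bernExp_sum, ← bernExp_const_mul]
    refine mul_nonpos_of_nonneg_of_nonpos (Real.exp_pos _).le (sub_nonpos.2 ?_)
    exact bernExp_mono hq.1.le hq.2.le h
  have h1 := hanti (Set.left_mem_Icc.2 zero_le_one) ⟨hp0, hp1⟩ hp0
  simp only [mul_zero, neg_zero, Real.exp_zero, one_mul, bernExp_zero] at h1
  have h2 := mul_le_mul_of_nonneg_left h1 (Real.exp_pos (κ * p)).le
  rwa [← mul_assoc, ← Real.exp_add, add_neg_cancel, Real.exp_zero, one_mul] at h2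

end BernoulliSubsets

/-! ### Degrees and spectral gap of the Erdős–Rényi graph. -/

section RandomGraph

open Matrix

variable {n : ℕ}

/-- The `0`-`1` weights supported on `S`. -/
noncomputable def indWeights (S : Set (Sym2 (Fin n))) : Weights n := S.indicator 1

lemma indWeights_nonneg (S : Set (Sym2 (Fin n))) (e : Sym2 (Fin n)) : 0 ≤ indWeights S e :=
  Set.indicator_nonneg (fun _ _ => zero_le_one) e

lemma wdeg_add (w w' : Weights n) (i : Fin n) : wdeg (w + w') i = wdeg w i + wdeg w' i := by
  simp [wdeg, Finset.sum_add_distrib]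

lemma wdeg_indWeights_singleton (e : Sym2 (Fin n)) (i : Fin n) [Decidable (i ∈ e)] :
    wdeg (indWeights {e}) i = if i ∈ e then 1 else 0 := by
  classical
  unfold wdeg indWeights
  split_ifs with h
  · obtain ⟨k, rfl⟩ := h
    rw [Finset.sum_eq_single k]
    · simp
    · intro j _ hj
      rw [Set.indicator_of_notMem]
      exact fun h => hj (Sym2.congr_right.1 h)
    · simp
  · refine Finset.sum_eq_zero fun j _ => Set.indicator_of_notMem ?_ _
    rintro rfl
    exact h (Sym2.mem_mk_left i j)

lemma indWeights_insert {S : Set (Sym2 (Fin n))} {e : Sym2 (Fin n)} (he : e ∉ S) :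
    indWeights (insert e S) = indWeights S + indWeights {e} := by
  unfold indWeights
  rw [Set.insert_eq, Set.union_comm, Set.indicator_union_of_disjoint
    (Set.disjoint_singleton_right.2 he)]
  rfl

lemma indWeights_insert_eq_erase_add [DecidableEq (Sym2 (Fin n))] (S : Finset (Sym2 (Fin n)))
    (e : Sym2 (Fin n)) : indWeights ((insert e S : Finset _) : Set (Sym2 (Fin n))) =
      indWeights ((S.erase e : Finset _) : Set (Sym2 (Fin n))) + indWeights {e} := by
  rw [← indWeights_insert (by simp), ← Finset.coe_insert]
  congr 2
  ext f
  by_cases hf : f = e <;> simp [hf]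

lemma lap_indWeights_singleton (e : Sym2 (Fin n)) : lap (indWeights {e}) = edgeLap e := by
  classical
  rw [lap, Finset.sum_eq_single e]
  · simp [indWeights]
  · intro f _ hf
    simp [indWeights, hf]
  · simp

/-- The non-loops. -/
noncomputable def nonLoops (n : ℕ) : Finset (Sym2 (Fin n)) := by
  classical exact Finset.univ.filter fun e => ¬ e.IsDiag

lemma mem_nonLoops {e : Sym2 (Fin n)} : e ∈ nonLoops n ↔ ¬ e.IsDiag := by
  simp [nonLoops]

lemma card_nonLoops : (nonLoops n).card = n.choose 2 := by
  classical
  have h := Sym2.card_subtype_not_diag (α := Fin n)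
  rw [Fintype.card_fin] at h
  rw [← h, Fintype.card_subtype]
  congr 1

/-- This is Markov's inequality: `ψ` is a nonnegative function of the edge set that is at least `1`
on the bad event. -/
lemma binomialRandom_le_bernExp (p : unitInterval) (B : Set (SimpleGraph (Fin n)))
    (ψ : Finset (Sym2 (Fin n)) → ℝ) (hψ0 : ∀ S, 0 ≤ ψ S)
    (hψ : ∀ G ∈ B, ∀ S : Finset (Sym2 (Fin n)), (S : Set _) = G.edgeSet → 1 ≤ ψ S) :
    SimpleGraph.binomialRandom (Fin n) p B ≤ ENNReal.ofReal (bernExp (nonLoops n) p ψ) := by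
  classical
  have hp0 : (0 : ℝ) ≤ p := p.2.1
  have hp1 : (0 : ℝ) ≤ 1 - p := sub_nonneg.2 p.2.2
  let T : Finset (SimpleGraph (Fin n)) := Finset.univ.filter (· ∈ B)
  have hterm : ∀ G ∈ T, SimpleGraph.binomialRandom (Fin n) p {G} ≤ ENNReal.ofReal
      ((p : ℝ) ^ G.edgeFinset.card * (1 - p) ^ ((nonLoops n).card - G.edgeFinset.card) *
        ψ G.edgeFinset) := by
    intro G hG
    have h1 := hψ G (Finset.mem_filter.1 hG).2 G.edgeFinset (by simp)
    have h2 : SimpleGraph.binomialRandom (Fin n) p {G} = ENNReal.ofReal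
        ((p : ℝ) ^ G.edgeFinset.card * (1 - p) ^ ((nonLoops n).card - G.edgeFinset.card)) := by
      rw [SimpleGraph.binomialRandom_singleton, Nat.card_eq_fintype_card, Fintype.card_fin,
        card_nonLoops, ENNReal.ofReal_mul (by positivity), ENNReal.ofReal_pow hp0,
        ENNReal.ofReal_pow hp1, ← SimpleGraph.coe_edgeFinset, Set.ncard_coe_finset]
      congr 2
      · congr 1
        exact (Real.toNNReal_of_nonneg hp0).symm
      · congr 1
        exact (Real.toNNReal_of_nonneg hp1).symm
    rw [h2]
    exact ENNReal.ofReal_le_ofReal (le_mul_of_one_le_right (by positivity) h1)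
  calc SimpleGraph.binomialRandom (Fin n) p B
      ≤ SimpleGraph.binomialRandom (Fin n) p (⋃ G ∈ T, {G}) :=
        measure_mono fun G hG => by simpa [T] using hG
    _ ≤ ∑ G ∈ T, SimpleGraph.binomialRandom (Fin n) p {G} := measure_biUnion_finset_le _ _
    _ ≤ ∑ G ∈ T, ENNReal.ofReal ((p : ℝ) ^ G.edgeFinset.card *
          (1 - p) ^ ((nonLoops n).card - G.edgeFinset.card) * ψ G.edgeFinset) :=
        Finset.sum_le_sum hterm
    _ = ENNReal.ofReal (∑ G ∈ T, ((p : ℝ) ^ G.edgeFinset.card *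
          (1 - p) ^ ((nonLoops n).card - G.edgeFinset.card) * ψ G.edgeFinset)) :=
        (ENNReal.ofReal_sum_of_nonneg fun G _ => by have := hψ0 G.edgeFinset; positivity).symm
    _ ≤ ENNReal.ofReal (bernExp (nonLoops n) p ψ) := by
        refine ENNReal.ofReal_le_ofReal ?_
        have hinj : Set.InjOn (fun G : SimpleGraph (Fin n) => G.edgeFinset) T := by
          intro G _ H _ hGH
          exact SimpleGraph.edgeFinset_inj.1 hGH
        rw [← Finset.sum_image (s := T) (g := fun G : SimpleGraph (Fin n) => G.edgeFinset)
          (f := fun S => (p : ℝ) ^ S.card * (1 - p) ^ ((nonLoops n).card - S.card) * ψ S) hinj]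
        refine Finset.sum_le_sum_of_subset_of_nonneg ?_ fun S _ _ => by
          have := hψ0 S
          positivity
        intro S hS
        obtain ⟨G, -, rfl⟩ := Finset.mem_image.1 hS
        rw [Finset.mem_powerset]
        intro e he
        exact mem_nonLoops.2 (G.not_isDiag_of_mem_edgeFinset he)

/-- Adding one edge to the graph with edge set `S` decreases the potential by at least a multiple of
its contribution to `⟨L, exp(-L_S / 4)⟩`. -/
lemma potential_insert_sub_erase_le [DecidableEq (Sym2 (Fin n))] (hn : n ≠ 0)
    (S : Finset (Sym2 (Fin n))) (e : Sym2 (Fin n)) :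
    potential (1 / 4) (indWeights ((insert e S : Finset _) : Set (Sym2 (Fin n)))) -
      potential (1 / 4) (indWeights ((S.erase e : Finset _) : Set (Sym2 (Fin n)))) ≤
    -(1 / 8) * matInner (edgeLap e)
      (NormedSpace.exp (-(1 / 4 : ℝ) • lap (indWeights (S : Set (Sym2 (Fin n)))))) := by
  classical
  -- With `s = 1/4` and `b = 1`, the coefficient `(1 - 2bs)s` of the decrease is `1/8`.
  have hins := indWeights_insert_eq_erase_add S e
  have h1 := potential_add_le hn (s := 1 / 4) (b := 1) (by norm_num) one_pos
    (indWeights ((S.erase e : Finset _) : Set (Sym2 (Fin n))))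
    (indWeights_nonneg {e}) (fun i => by
      rw [wdeg_indWeights_singleton]; split_ifs <;> norm_num)
  have h2 : matInner (edgeLap e)
      (NormedSpace.exp (-(1 / 4 : ℝ) • lap (indWeights (S : Set (Sym2 (Fin n)))))) ≤
      matInner (edgeLap e) (NormedSpace.exp
        (-(1 / 4 : ℝ) • lap (indWeights ((S.erase e : Finset _) : Set (Sym2 (Fin n)))))) := by
    by_cases heS : e ∈ S
    · have := matInner_lap_exp_add_le (s := 1 / 4)
        (indWeights ((S.erase e : Finset _) : Set (Sym2 (Fin n)))) (indWeights {e}) (by norm_num)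
      rwa [← hins, Finset.insert_eq_of_mem heS, lap_indWeights_singleton] at this
    · rw [Finset.erase_eq_of_notMem heS]
  rw [← hins, lap_indWeights_singleton] at h1
  linarith

lemma sum_nonLoops_matInner_edgeLap (hn : n ≠ 0) (B : Matrix (Fin n) (Fin n) ℝ) :
    ∑ e ∈ nonLoops n, matInner (edgeLap e) B = n * matInner (projPerpOnes n) B := by
  classical
  have h := matInner_lap (1 : Weights n) B
  rw [lap_one hn] at h
  have h1 : matInner ((n : ℝ) • projPerpOnes n) B = n * matInner (projPerpOnes n) B := by
    simp only [matInner, Finset.mul_sum, Matrix.smul_apply, smul_eq_mul, mul_assoc]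
  rw [← h1, h, Finset.sum_subset (Finset.subset_univ (nonLoops n))]
  · simp
  · intro e _ he
    rw [mem_nonLoops, not_not] at he
    induction e with | _ i j => ?_
    obtain rfl : i = j := he
    simp [matInner]

/-- The one-edge decreases sum to at least `n/8` times the potential, since the edge Laplacians sum
to `nΠ`. Hence the expected potential decays at rate `n/8` in `p`. -/
lemma bernExp_potential_le (hn : n ≠ 0) {p : ℝ} (hp0 : 0 ≤ p) (hp1 : p ≤ 1) :
    bernExp (nonLoops n) p (fun S => potential (1 / 4) (indWeights (S : Set (Sym2 (Fin n))))) ≤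
      Real.exp (-(n / 8) * p) * (n - 1) := by
  classical
  have h := bernExp_le_exp (E := nonLoops n) (κ := -(n / 8 : ℝ))
    (φ := fun S => potential (1 / 4) (indWeights (S : Set (Sym2 (Fin n))))) (fun S _ => by
      refine (Finset.sum_le_sum fun e _ => potential_insert_sub_erase_le hn S e).trans ?_
      rw [← Finset.mul_sum, sum_nonLoops_matInner_edgeLap hn]
      apply le_of_eq
      rw [potential]
      ring) hp0 hp1
  have h0 : indWeights ((∅ : Finset (Sym2 (Fin n))) : Set (Sym2 (Fin n))) = 0 := by
    rw [Finset.coe_empty, indWeights, Set.indicator_empty']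
  rwa [h0, potential_zero_weights hn] at h

/-- An edge at `i` doubles `2 ^ deg i` and any other edge leaves it unchanged. At most `n` edges
meet `i`, so the growth rate in `p` is at most `n`. -/
lemma bernExp_two_pow_wdeg_le (i : Fin n) {p : ℝ} (hp0 : 0 ≤ p) (hp1 : p ≤ 1) :
    bernExp (nonLoops n) p
      (fun S => Real.exp (Real.log 2 * wdeg (indWeights (S : Set (Sym2 (Fin n)))) i)) ≤
      Real.exp (n * p) := by
  classical
  have h := bernExp_le_exp (E := nonLoops n) (κ := (n : ℝ))
    (φ := fun S => Real.exp (Real.log 2 * wdeg (indWeights (S : Set (Sym2 (Fin n)))) i))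
    (fun S _ => by
      have hterm : ∀ e ∈ nonLoops n,
          Real.exp (Real.log 2 * wdeg (indWeights ((insert e S : Finset _) : Set _)) i) -
          Real.exp (Real.log 2 * wdeg (indWeights ((S.erase e : Finset _) : Set _)) i) ≤
          wdeg (indWeights {e}) i *
            Real.exp (Real.log 2 * wdeg (indWeights (S : Set (Sym2 (Fin n)))) i) := by
        intro e _
        have hins := indWeights_insert_eq_erase_add S e
        have hmono : wdeg (indWeights ((S.erase e : Finset _) : Set (Sym2 (Fin n)))) i ≤
            wdeg (indWeights (S : Set (Sym2 (Fin n)))) i :=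
          Finset.sum_le_sum fun j _ => Set.indicator_le_indicator_of_subset
            (by simp) (fun _ => zero_le_one) _
        rw [hins, wdeg_add, wdeg_indWeights_singleton]
        split_ifs
        · rw [mul_add, Real.exp_add, mul_one, Real.exp_log two_pos, one_mul]
          have := Real.exp_le_exp.2
            (mul_le_mul_of_nonneg_left hmono (Real.log_pos one_lt_two).le)
          linarith
        · simp
      refine (Finset.sum_le_sum hterm).trans ?_
      rw [← Finset.sum_mul]
      refine mul_le_mul_of_nonneg_right ?_ (Real.exp_pos _).le
      unfold wdeg
      rw [Finset.sum_comm]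
      calc ∑ j : Fin n, ∑ e ∈ nonLoops n, indWeights {e} s(i, j) ≤ ∑ j : Fin n, (1 : ℝ) := by
            refine Finset.sum_le_sum fun j _ => ?_
            have : ∀ e, indWeights {e} s(i, j) = if s(i, j) = e then (1 : ℝ) else 0 := fun e => by
              simp [indWeights, Set.indicator_apply]
            simp only [this, Finset.sum_ite_eq]
            split_ifs <;> norm_num
        _ = n := by simp) hp0 hp1
  have h0 : wdeg (indWeights ((∅ : Finset (Sym2 (Fin n))) : Set (Sym2 (Fin n)))) i = 0 := by
    simp [indWeights, wdeg]
  rwa [h0, mul_zero, Real.exp_zero, mul_one] at h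

/-- On the bad event the potential exceeds `exp(-np/16)`, whereas its expectation is below `n
exp(-np/8)`. -/
lemma binomialRandom_objective_lt (hn : 2 ≤ n) (p : unitInterval) :
    SimpleGraph.binomialRandom (Fin n) p {G | objective (indWeights G.edgeSet) < n * p / 4} ≤
      ENNReal.ofReal (n * Real.exp (-(n * p / 16))) := by
  have hn0 : n ≠ 0 := by omega
  refine (binomialRandom_le_bernExp p _ (fun S => Real.exp (n * p / 16) *
    potential (1 / 4) (indWeights (S : Set (Sym2 (Fin n)))))
    (fun S => mul_nonneg (Real.exp_pos _).le (potential_pos hn _ _).le) ?_).trans ?_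
  · intro G hG S hS
    have h := neg_log_potential_le hn (s := 1 / 4) (by norm_num) (indWeights (S : Set (Sym2 (Fin n))))
    have hpos := potential_pos hn (1 / 4) (indWeights (S : Set (Sym2 (Fin n))))
    rw [Set.mem_ofPred_eq, ← hS] at hG
    rw [← Real.exp_log hpos, ← Real.exp_add]
    exact Real.one_le_exp (by linarith)
  · refine ENNReal.ofReal_le_ofReal ?_
    rw [bernExp_const_mul]
    refine (mul_le_mul_of_nonneg_left (bernExp_potential_le hn0 p.2.1 p.2.2)
      (Real.exp_pos _).le).trans ?_
    rw [← mul_assoc, ← Real.exp_add, mul_comm, show (n : ℝ) * p / 16 + -(n / 8) * p =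
      -(n * p / 16) by ring]
    exact mul_le_mul_of_nonneg_right (by linarith) (Real.exp_pos _).le

lemma binomialRandom_lt_wdeg (p : unitInterval) (i : Fin n) :
    SimpleGraph.binomialRandom (Fin n) p {G | 2 * n * (p : ℝ) < wdeg (indWeights G.edgeSet) i} ≤
      ENNReal.ofReal (Real.exp (-(n * p / 16))) := by
  have hp0 : (0 : ℝ) ≤ p := p.2.1
  refine (binomialRandom_le_bernExp p _ (fun S => Real.exp (-(Real.log 2 * (2 * n * (p : ℝ)))) *
    Real.exp (Real.log 2 * wdeg (indWeights (S : Set (Sym2 (Fin n)))) i))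
    (fun S => by positivity) ?_).trans ?_
  · intro G hG S hS
    rw [Set.mem_ofPred_eq, ← hS] at hG
    rw [← Real.exp_add]
    have := mul_le_mul_of_nonneg_left hG.le (Real.log_pos one_lt_two).le
    exact Real.one_le_exp (by linarith)
  · refine ENNReal.ofReal_le_ofReal ?_
    rw [bernExp_const_mul]
    refine (mul_le_mul_of_nonneg_left (bernExp_two_pow_wdeg_le i hp0 p.2.2)
      (Real.exp_pos _).le).trans ?_
    rw [← Real.exp_add, Real.exp_le_exp]
    have h1 : 0 ≤ (n : ℝ) * p := by positivity
    -- The exponent is `np(1 - 2 log 2)`, which is below `-np/16`.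
    nlinarith [Real.log_two_gt_d9]

/-- The graphs all of whose degrees are at most `2np` and whose Laplacian has spectral gap at least
`np/4`. -/
def IsWellConnected (p : ℝ) (G : SimpleGraph (Fin n)) : Prop :=
  (∀ i, wdeg (indWeights G.edgeSet) i ≤ 2 * n * p) ∧ n * p / 4 ≤ objective (indWeights G.edgeSet)

lemma binomialRandom_not_isWellConnected (hn : 2 ≤ n) (p : unitInterval)
    (hp : 208 * Real.log n / n ≤ (p : ℝ)) :
    SimpleGraph.binomialRandom (Fin n) p {G | ¬ IsWellConnected p G} ≤
      ENNReal.ofReal (((n : ℝ) ^ 11)⁻¹) := by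
  have hn0 : (0 : ℝ) < n := by positivity
  have hsub : {G : SimpleGraph (Fin n) | ¬ IsWellConnected p G} ⊆
      (⋃ i, {G | 2 * n * (p : ℝ) < wdeg (indWeights G.edgeSet) i}) ∪
        {G | objective (indWeights G.edgeSet) < n * p / 4} := by
    intro G hG
    by_contra hcon
    simp only [Set.mem_union, Set.mem_iUnion, Set.mem_ofPred_eq, not_or, not_exists, not_lt] at hcon
    exact hG hcon
  refine (measure_mono hsub).trans ((measure_union_le _ _).trans ?_)
  have hdeg : SimpleGraph.binomialRandom (Fin n) p
      (⋃ i, {G | 2 * n * (p : ℝ) < wdeg (indWeights G.edgeSet) i}) ≤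
      ENNReal.ofReal (n * Real.exp (-(n * p / 16))) := by
    refine (measure_iUnion_le _).trans ?_
    rw [tsum_fintype]
    refine (Finset.sum_le_sum fun i _ => binomialRandom_lt_wdeg p i).trans ?_
    rw [Finset.sum_const, Finset.card_univ, Fintype.card_fin, nsmul_eq_mul,
      ENNReal.ofReal_mul hn0.le, ENNReal.ofReal_natCast]
  refine (add_le_add hdeg (binomialRandom_objective_lt hn p)).trans ?_
  · rw [← ENNReal.ofReal_add (by positivity) (by positivity)]
    refine ENNReal.ofReal_le_ofReal ?_
    -- The constant is `208 = 13 · 16`: each of the two bounds becomes `n · n⁻¹³`, and their sum is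
    -- at most `n² · n⁻¹³`.
    have h1 : 13 * Real.log n ≤ n * p / 16 := by
      rw [div_le_iff₀ hn0] at hp
      linarith
    have h2 : Real.exp (-(n * p / 16)) ≤ ((n : ℝ) ^ 13)⁻¹ := by
      rw [← Real.exp_log (show (0 : ℝ) < n ^ 13 by positivity), ← Real.exp_neg, Real.exp_le_exp,
        Real.log_pow]
      push_cast
      linarith
    have h3 : (2 : ℝ) ≤ n := by exact_mod_cast hn
    calc (n : ℝ) * Real.exp (-(n * p / 16)) + n * Real.exp (-(n * p / 16))
        = 2 * n * Real.exp (-(n * p / 16)) := by ring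
      _ ≤ n * n * ((n : ℝ) ^ 13)⁻¹ := by gcongr
      _ = ((n : ℝ) ^ 11)⁻¹ := by field_simp

end RandomGraph

/-! ### Concentration of random sign sketches. -/

section RandomSigns

variable {n k : ℕ}

/-- The sign encoded by a Boolean. -/
def sign (b : Bool) : ℝ := if b then 1 else -1

lemma sign_eq (b : Bool) : sign b = 1 ∨ sign b = -1 := by
  cases b <;> simp [sign]

lemma sum_prod_signs (f : Fin n → Bool → ℝ) :
    ∑ σ : Fin n → Bool, ∏ i, f i (σ i) = ∏ i, (f i true + f i false) := by
  have := (Fintype.prod_sum f).symm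
  simpa [Fintype.sum_bool] using this

/-- The Rademacher sum with coefficients `x`. -/
def radSum (x : Fin n → ℝ) (σ : Fin n → Bool) : ℝ := ∑ i, sign (σ i) * x i

lemma sum_exp_radSum_le {x : Fin n → ℝ} (hx : ∑ i, x i ^ 2 = 1) (t : ℝ) :
    ∑ σ, Real.exp (t * radSum x σ) ≤ 2 ^ n * Real.exp (t ^ 2 / 2) := by
  have h1 : ∀ σ, Real.exp (t * radSum x σ) = ∏ i, Real.exp (t * (sign (σ i) * x i)) := fun σ => by
    rw [radSum, Finset.mul_sum, Real.exp_sum]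
  rw [Finset.sum_congr rfl fun σ _ => h1 σ,
    sum_prod_signs (fun i b => Real.exp (t * (sign b * x i)))]
  calc ∏ i, (Real.exp (t * (sign true * x i)) + Real.exp (t * (sign false * x i)))
      = ∏ i, 2 * Real.cosh (t * x i) := Finset.prod_congr rfl fun i _ => by
        rw [Real.cosh_eq, mul_div_cancel₀ _ (two_ne_zero' ℝ)]
        simp [sign]
    _ ≤ ∏ i, 2 * Real.exp ((t * x i) ^ 2 / 2) := by
        gcongr with i
        exact Real.cosh_le_exp_half_sq _
    _ = 2 ^ n * Real.exp (t ^ 2 / 2) := by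
        rw [Finset.prod_mul_distrib, Finset.prod_const, Finset.card_univ, Fintype.card_fin,
          ← Real.exp_sum]
        congr 2
        simp only [mul_pow, ← Finset.sum_div, ← Finset.mul_sum, hx, mul_one]

lemma integrable_exp_neg_sq_add (y : ℝ) :
    Integrable fun g : ℝ => Real.exp (-g ^ 2 + g * y) := by
  have h := ((integrable_exp_neg_mul_sq one_pos).comp_sub_right (y / 2)).const_mul
    (Real.exp (y ^ 2 / 4))
  refine h.congr (Filter.Eventually.of_forall fun g => ?_)
  simp only
  rw [← Real.exp_add]
  congr 1
  ring

lemma integral_exp_neg_sq_add (y : ℝ) :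
    ∫ g : ℝ, Real.exp (-g ^ 2 + g * y) = Real.exp (y ^ 2 / 4) * √Real.pi := by
  have h : ∀ g : ℝ, Real.exp (-g ^ 2 + g * y) =
      Real.exp (y ^ 2 / 4) * Real.exp (-1 * (g - y / 2) ^ 2) := fun g => by
    rw [← Real.exp_add]
    congr 1
    ring
  simp only [h]
  rw [integral_const_mul, integral_sub_right_eq_self (fun g => Real.exp (-1 * g ^ 2)) (y / 2),
    integral_gaussian, div_one]

/-- The square in the exponent is linearised by a Gaussian integral, `√π exp(y²/4) = ∫ exp(-g² + gy)
dg`. The subgaussian bound at `t = g` leaves `∫ exp(-g²/2) dg = √(2π)`. -/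
lemma sum_exp_sq_radSum_le {x : Fin n → ℝ} (hx : ∑ i, x i ^ 2 = 1) :
    ∑ σ, Real.exp (radSum x σ ^ 2 / 4) ≤ 2 ^ n * √2 := by
  have hpi : 0 < √Real.pi := Real.sqrt_pos.2 Real.pi_pos
  refine le_of_mul_le_mul_right ?_ hpi
  rw [Finset.sum_mul]
  simp only [← integral_exp_neg_sq_add]
  rw [← integral_finsetSum _ fun σ _ => integrable_exp_neg_sq_add _]
  have h1 : ∀ g : ℝ, ∑ σ, Real.exp (-g ^ 2 + g * radSum x σ) ≤
      2 ^ n * Real.exp (-(1 / 2) * g ^ 2) := fun g => by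
    simp only [Real.exp_add, ← Finset.mul_sum]
    refine (mul_le_mul_of_nonneg_left (sum_exp_radSum_le hx g) (Real.exp_pos _).le).trans
      (le_of_eq ?_)
    rw [mul_left_comm, ← Real.exp_add]
    congr 2
    ring
  refine (integral_mono (integrable_finsetSum _ fun σ _ => integrable_exp_neg_sq_add _)
    ((integrable_exp_neg_mul_sq (by norm_num)).const_mul _) h1).trans (le_of_eq ?_)
  rw [integral_const_mul, integral_gaussian, mul_assoc, ← Real.sqrt_mul zero_le_two]
  congr 2
  ring

lemma sum_sign_mul_sign (i j : Fin n) :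
    ∑ σ : Fin n → Bool, sign (σ i) * sign (σ j) = if i = j then 2 ^ n else 0 := by
  split_ifs with h
  · subst h
    have : ∀ b, sign b * sign b = 1 := fun b => by cases b <;> simp [sign]
    simp [this]
  · have h1 : ∀ σ : Fin n → Bool, sign (σ i) * sign (σ j) =
        ∏ l, (if l = i then sign (σ l) else 1) * (if l = j then sign (σ l) else 1) := fun σ => by
      rw [Finset.prod_mul_distrib]
      simp
    rw [Finset.sum_congr rfl fun σ _ => h1 σ, sum_prod_signs
      (fun l b => (if l = i then sign b else 1) * (if l = j then sign b else 1))]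
    refine Finset.prod_eq_zero (Finset.mem_univ i) ?_
    simp [h, sign]

lemma sum_sq_radSum {x : Fin n → ℝ} (hx : ∑ i, x i ^ 2 = 1) :
    ∑ σ, radSum x σ ^ 2 = 2 ^ n := by
  have h1 : ∀ σ, radSum x σ ^ 2 = ∑ i, ∑ j, x i * x j * (sign (σ i) * sign (σ j)) := fun σ => by
    rw [radSum, sq, Finset.sum_mul_sum]
    exact Finset.sum_congr rfl fun i _ => Finset.sum_congr rfl fun j _ => by ring
  rw [Finset.sum_congr rfl fun σ _ => h1 σ, Finset.sum_comm,
    Finset.sum_congr rfl fun i _ => Finset.sum_comm]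
  simp only [← Finset.mul_sum, sum_sign_mul_sign, mul_ite, mul_zero, Finset.sum_ite_eq,
    Finset.mem_univ, if_true, ← Finset.sum_mul, ← sq, hx, one_mul]

lemma exp_le_one_add_add_sq_mul (u : ℝ) :
    Real.exp u ≤ 1 + u + u ^ 2 * Real.exp |u| := by
  rcases le_or_gt |u| 1 with h | h
  · have h1 := (abs_le.1 (Real.abs_exp_sub_one_sub_id_le h)).2
    have h2 := le_mul_of_one_le_right (sq_nonneg u) (Real.one_le_exp (abs_nonneg u))
    linarith
  · rcases le_total 0 u with hu | hu
    · rw [abs_of_nonneg hu] at h ⊢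
      have := le_mul_of_one_le_left (Real.exp_pos u).le (show 1 ≤ u ^ 2 by nlinarith)
      linarith
    · rw [abs_of_nonpos hu] at h ⊢
      have h1 := Real.exp_le_one_iff.2 hu
      have h2 := le_mul_of_one_le_right (sq_nonneg u)
        (Real.one_le_exp (show 0 ≤ -u by linarith))
      nlinarith

/-- The centred square of a normalized Rademacher sum is sub-exponential. -/
lemma sum_exp_sq_radSum_sub_one_le {x : Fin n → ℝ} (hx : ∑ i, x i ^ 2 = 1) {r : ℝ}
    (hr : |r| ≤ 1 / 8) :
    ∑ σ, Real.exp (r * (radSum x σ ^ 2 - 1)) ≤ 2 ^ n * Real.exp (256 * r ^ 2) := by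
  -- Second-order expansion of the exponential. Since `|r| ≤ 1/8`, both the square and the
  -- exponential in the remainder are controlled by `exp((y + 1)/8)`; their product is `exp(1/4)
  -- exp(y/4)`, whose sum over signs is known. The linear term sums to zero.
  have hterm : ∀ σ, Real.exp (r * (radSum x σ ^ 2 - 1)) ≤ 1 + r * (radSum x σ ^ 2 - 1) +
      128 * r ^ 2 * Real.exp (1 / 4) * Real.exp (radSum x σ ^ 2 / 4) := fun σ => by
    set y := radSum x σ ^ 2 with hy
    have hy0 : 0 ≤ y := sq_nonneg _
    refine (exp_le_one_add_add_sq_mul _).trans (add_le_add_right ?_ _)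
    have h1 : |r * (y - 1)| ≤ (y + 1) / 8 := by
      rw [abs_mul]
      calc |r| * |y - 1| ≤ 1 / 8 * (y + 1) := by
            gcongr
            exact abs_le.2 ⟨by linarith, by linarith⟩
        _ = (y + 1) / 8 := by ring
    -- The constant is `128 = 2 · 8²`, from the quadratic term of `exp((y + 1)/8)`.
    have h2 : (y - 1) ^ 2 ≤ 128 * Real.exp ((y + 1) / 8) := by
      have := Real.quadratic_le_exp_of_nonneg (show 0 ≤ (y + 1) / 8 by positivity)
      nlinarith
    calc (r * (y - 1)) ^ 2 * Real.exp |r * (y - 1)|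
        ≤ r ^ 2 * (128 * Real.exp ((y + 1) / 8)) * Real.exp ((y + 1) / 8) := by
          rw [mul_pow]
          gcongr
      _ = 128 * r ^ 2 * (Real.exp ((y + 1) / 8) * Real.exp ((y + 1) / 8)) := by ring
      _ = 128 * r ^ 2 * Real.exp (1 / 4) * Real.exp (y / 4) := by
          rw [← Real.exp_add, mul_assoc (128 * r ^ 2), ← Real.exp_add]
          congr 2
          ring
  refine (Finset.sum_le_sum fun σ _ => hterm σ).trans ?_
  have hcard : ∑ _σ : Fin n → Bool, (1 : ℝ) = 2 ^ n := by simp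
  rw [Finset.sum_add_distrib, Finset.sum_add_distrib, ← Finset.mul_sum, ← Finset.mul_sum,
    Finset.sum_sub_distrib, sum_sq_radSum hx, hcard, sub_self, mul_zero, add_zero]
  have h1 := mul_le_mul_of_nonneg_left (sum_exp_sq_radSum_le hx)
    (show 0 ≤ 128 * r ^ 2 * Real.exp (1 / 4) by positivity)
  have h2 : Real.exp (1 / 4) * √2 ≤ 2 := by
    have h3 : Real.exp (1 / 4) ≤ 4 / 3 := by
      have := Real.add_one_le_exp (-(1 / 4) : ℝ)
      rw [Real.exp_neg] at this
      rw [← inv_inv (Real.exp (1 / 4))]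
      refine inv_le_of_inv_le₀ (by norm_num) ?_
      linarith
    have h4 : √2 ≤ 3 / 2 := by
      rw [Real.sqrt_le_left (by norm_num)]
      norm_num
    calc Real.exp (1 / 4) * √2 ≤ 4 / 3 * (3 / 2) := by gcongr
      _ = 2 := by norm_num
  have h5 := Real.add_one_le_exp (256 * r ^ 2)
  have h6 : 128 * r ^ 2 * Real.exp (1 / 4) * (2 ^ n * √2) ≤ 2 ^ n * (256 * r ^ 2) := by
    calc 128 * r ^ 2 * Real.exp (1 / 4) * (2 ^ n * √2)
        = 128 * r ^ 2 * 2 ^ n * (Real.exp (1 / 4) * √2) := by ring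
      _ ≤ 128 * r ^ 2 * 2 ^ n * 2 := by gcongr
      _ = 2 ^ n * (256 * r ^ 2) := by ring
  have h7 : (0 : ℝ) < 2 ^ n := by positivity
  nlinarith

/-- The sum over all `n × k` sign matrices of a function that factors over the columns. -/
lemma sum_prod_columns (f : (Fin n → Bool) → ℝ) :
    ∑ σ : Fin n → Fin k → Bool, ∏ l, f (fun i => σ i l) = (∑ τ, f τ) ^ k := by
  rw [← Equiv.sum_comp (Equiv.piComm fun (_ : Fin k) (_ : Fin n) => Bool)]
  have := Fintype.prod_sum (fun (_ : Fin k) τ => f τ)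
  rw [Finset.prod_const, Finset.card_univ, Fintype.card_fin] at this
  exact this.symm

/-- The relative error of `‖Rᵀ y‖²` as an estimate of `‖y‖²`. -/
noncomputable def relError (y : Fin n → ℝ) (R : Fin n → Fin k → ℝ) : ℝ :=
  (∑ l, (∑ i, R i l * y i) ^ 2) / (∑ i, y i ^ 2) - 1

/-- The sign matrix encoded by a Boolean matrix. -/
noncomputable def toSignMatrix (σ : Fin n → Fin k → Bool) : Fin n → Fin k → ℝ :=
  fun i l => sign (σ i l) * (1 / √(k : ℝ))

/-- The relative error is the average over the `k` columns of centred squares of normalised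
Rademacher sums, so its exponential factors over the columns. -/
lemma relError_toSignMatrix (hk : k ≠ 0) {y : Fin n → ℝ} (hy : ∑ i, y i ^ 2 ≠ 0)
    (σ : Fin n → Fin k → Bool) :
    relError y (toSignMatrix σ) =
      (∑ l, (radSum (fun i => y i / √(∑ i, y i ^ 2)) (fun i => σ i l) ^ 2 - 1)) / k := by
  have hk' : (k : ℝ) ≠ 0 := by exact_mod_cast hk
  have hk2 : √(k : ℝ) ^ 2 = k := Real.sq_sqrt (Nat.cast_nonneg k)
  have hy2 : √(∑ i, y i ^ 2) ^ 2 = ∑ i, y i ^ 2 :=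
    Real.sq_sqrt (Finset.sum_nonneg fun i _ => sq_nonneg _)
  have h1 : ∀ l, (∑ i, toSignMatrix σ i l * y i) ^ 2 =
      (∑ i, y i ^ 2) * radSum (fun i => y i / √(∑ i, y i ^ 2)) (fun i => σ i l) ^ 2 / k := by
    intro l
    have h2 : radSum (fun i => y i / √(∑ i, y i ^ 2)) (fun i => σ i l) =
        (∑ i, sign (σ i l) * y i) / √(∑ i, y i ^ 2) := by
      rw [radSum, Finset.sum_div]
      exact Finset.sum_congr rfl fun i _ => by ring
    have h3 : ∑ i, toSignMatrix σ i l * y i = (∑ i, sign (σ i l) * y i) / √(k : ℝ) := by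
      rw [Finset.sum_div]
      exact Finset.sum_congr rfl fun i _ => by rw [toSignMatrix]; ring
    rw [h2, h3, div_pow, div_pow, hk2, hy2, mul_div_cancel₀ _ hy]
  rw [relError, Finset.sum_congr rfl fun l _ => h1 l, ← Finset.sum_div, ← Finset.mul_sum,
    Finset.sum_sub_distrib]
  simp
  field_simp

lemma sum_exp_relError_le (hk : k ≠ 0) {y : Fin n → ℝ} (hy : ∑ i, y i ^ 2 ≠ 0) {r : ℝ}
    (hr : |r| ≤ 1 / 8) :
    ∑ σ : Fin n → Fin k → Bool, Real.exp (r * k * relError y (toSignMatrix σ)) ≤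
      (2 ^ n) ^ k * Real.exp (256 * r ^ 2 * k) := by
  have hk' : (k : ℝ) ≠ 0 := by exact_mod_cast hk
  have hx : ∑ i, (y i / √(∑ i, y i ^ 2)) ^ 2 = 1 := by
    simp only [div_pow, ← Finset.sum_div]
    rw [Real.sq_sqrt (Finset.sum_nonneg fun i _ => sq_nonneg _), div_self hy]
  have h1 : ∀ σ : Fin n → Fin k → Bool, Real.exp (r * k * relError y (toSignMatrix σ)) =
      ∏ l, Real.exp (r * (radSum (fun i => y i / √(∑ i, y i ^ 2)) (fun i => σ i l) ^ 2 - 1)) := by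
    intro σ
    rw [relError_toSignMatrix hk hy, ← Real.exp_sum, ← Finset.mul_sum]
    congr 1
    field_simp
  rw [Finset.sum_congr rfl fun σ _ => h1 σ, sum_prod_columns fun τ =>
    Real.exp (r * (radSum (fun i => y i / √(∑ i, y i ^ 2)) τ ^ 2 - 1))]
  refine (pow_le_pow_left₀ (Finset.sum_nonneg fun _ _ => (Real.exp_pos _).le)
    (sum_exp_sq_radSum_sub_one_le hx hr) k).trans (le_of_eq ?_)
  rw [mul_pow, ← Real.exp_nat_mul]
  congr 2
  ring

/-- From `x ≤ c⁻¹ exp(cx)`. Bounding the excess, rather than the probability of an error above `ε`,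
produces a quantity that can be summed over rounds. -/
lemma max_sub_le_exp {c ε z : ℝ} (hc : 0 < c) :
    max 0 (|z| - ε) ≤ c⁻¹ * Real.exp (-(c * ε)) * (Real.exp (c * z) + Real.exp (-c * z)) := by
  have h1 : Real.exp (c * |z|) ≤ Real.exp (c * z) + Real.exp (-c * z) := by
    rcases abs_cases z with ⟨h, -⟩ | ⟨h, -⟩ <;> rw [h]
    · linarith [Real.exp_pos (-c * z)]
    · rw [mul_neg, ← neg_mul]
      linarith [Real.exp_pos (c * z)]
  have h2 : max 0 (|z| - ε) ≤ c⁻¹ * Real.exp (c * (|z| - ε)) := by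
    refine max_le (by positivity) ?_
    rw [← div_eq_inv_mul, le_div_iff₀ hc]
    linarith [Real.add_one_le_exp (c * (|z| - ε))]
  refine h2.trans ?_
  rw [mul_assoc]
  refine mul_le_mul_of_nonneg_left ?_ (inv_nonneg.2 hc.le)
  rw [show c * (|z| - ε) = -(c * ε) + c * |z| by ring, Real.exp_add]
  exact mul_le_mul_of_nonneg_left h1 (Real.exp_pos _).le

/-- The expected amount by which the relative error of a random sign sketch exceeds `ε`. -/
lemma sum_excess_le (hk : k ≠ 0) {y : Fin n → ℝ} (hy : ∑ i, y i ^ 2 ≠ 0) {ε : ℝ} (hε : 0 < ε)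
    (hε1 : ε ≤ 1 / 2) :
    ∑ σ : Fin n → Fin k → Bool, max 0 (|relError y (toSignMatrix σ)| - ε) ≤
      (2 ^ n) ^ k * (1024 / (ε * k) * Real.exp (-(ε ^ 2 * k / 1024))) := by
  have hk' : (0 : ℝ) < k := by exact_mod_cast Nat.pos_of_ne_zero hk
  -- The choice `r = ε/512` minimises the exponent `256 r² k - rkε`, with minimum `-ε² k / 1024`.
  have hc : 0 < ε / 512 * k := by positivity
  refine (Finset.sum_le_sum fun σ _ => max_sub_le_exp hc).trans ?_
  rw [← Finset.mul_sum, Finset.sum_add_distrib]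
  have hr : |ε / 512| ≤ 1 / 8 := by
    rw [abs_of_pos (by positivity)]
    linarith
  have h1 := sum_exp_relError_le hk hy hr
  have h2 := sum_exp_relError_le hk hy (r := -(ε / 512)) (by rwa [abs_neg])
  simp only [neg_sq, neg_mul] at h1 h2 ⊢
  refine (mul_le_mul_of_nonneg_left (add_le_add h1 h2) (by positivity)).trans (le_of_eq ?_)
  have h3 : Real.exp (-(ε ^ 2 * k / 1024)) =
      Real.exp (-(ε / 512 * k * ε)) * Real.exp (256 * (ε / 512) ^ 2 * k) := by
    rw [← Real.exp_add]
    congr 1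
    ring
  rw [h3]
  field_simp
  ring

lemma toSignMatrix_injective (hk : k ≠ 0) :
    Function.Injective (toSignMatrix : (Fin n → Fin k → Bool) → Fin n → Fin k → ℝ) := by
  intro σ τ h
  have hk' : (0 : ℝ) < √(k : ℝ) := Real.sqrt_pos.2 (by exact_mod_cast Nat.pos_of_ne_zero hk)
  ext i l
  have h1 := congrFun (congrFun h i) l
  simp only [toSignMatrix] at h1
  have h2 := mul_right_cancel₀ (one_div_pos.2 hk').ne' h1
  revert h2
  cases σ i l <;> cases τ i l <;> simp [sign] <;> norm_num

lemma range_toSignMatrix :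
    Set.range (toSignMatrix : (Fin n → Fin k → Bool) → _) = signMatrices n k := by
  ext R
  constructor
  · rintro ⟨σ, rfl⟩ i l
    rcases sign_eq (σ i l) with h | h <;> simp [toSignMatrix, h]
  · intro hR
    classical
    refine ⟨fun i l => decide (R i l = 1 / √(k : ℝ)), ?_⟩
    ext i l
    by_cases h : R i l = 1 / √(k : ℝ)
    · simp [toSignMatrix, sign, h]
    · have h' := (hR i l).resolve_left h
      simp only [toSignMatrix, sign, decide_eq_true_eq, if_neg h]
      rw [h', neg_one_mul]

lemma lintegral_uniformOn_signMatrices (hk : k ≠ 0) {g : (Fin n → Fin k → ℝ) → ℝ}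
    (hg : ∀ R, 0 ≤ g R) {B : ℝ} (hB : ∑ σ, g (toSignMatrix σ) ≤ (2 ^ n) ^ k * B) :
    ∫⁻ R, ENNReal.ofReal (g R) ∂(uniformOn (signMatrices n k)) ≤ ENNReal.ofReal B := by
  classical
  let s : Finset (Fin n → Fin k → ℝ) := Finset.univ.image toSignMatrix
  have hs : signMatrices n k = s := by
    rw [← range_toSignMatrix]
    simp [s]
  have hcard : s.card = (2 ^ n) ^ k := by
    rw [Finset.card_image_of_injective _ (toSignMatrix_injective hk), Finset.card_univ]
    simp [← pow_mul, mul_comm]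
  rw [hs, uniformOn, ProbabilityTheory.cond, lintegral_smul_measure, Measure.count_apply_finset, hcard,
    lintegral_finset]
  simp only [Measure.count_singleton, mul_one, smul_eq_mul]
  rw [← ENNReal.ofReal_sum_of_nonneg fun R _ => hg R,
    Finset.sum_image fun _ _ _ _ h => toSignMatrix_injective hk h]
  refine (mul_le_mul_right (ENNReal.ofReal_le_ofReal hB) _).trans ?_
  rw [ENNReal.ofReal_mul (by positivity), ← mul_assoc,
    show ENNReal.ofReal ((2 ^ n) ^ k) = (((2 ^ n) ^ k : ℕ) : ENNReal) by
      rw [← ENNReal.ofReal_natCast]; push_cast; rfl,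
    ENNReal.inv_mul_cancel (by simp) (ENNReal.natCast_ne_top _), one_mul]

end RandomSigns

/-! ### The greedy oracle and linear programming duality. -/

section Greedy

variable {n : ℕ}

lemma residual_le {b : ℝ} {w : Weights n} {e : Sym2 (Fin n)} {i : Fin n} (hi : i ∈ e) :
    residual b w e ≤ b - wdeg w i := by
  obtain ⟨j, rfl⟩ := hi
  exact min_le_left _ _

lemma exists_residual_eq (b : ℝ) (w : Weights n) (e : Sym2 (Fin n)) :
    ∃ i ∈ e, residual b w e = b - wdeg w i := by
  induction e with | _ i j => ?_
  rcases min_choice (b - wdeg w i) (b - wdeg w j) with h | h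
  · exact ⟨i, Sym2.mem_mk_left i j, h⟩
  · exact ⟨j, Sym2.mem_mk_right i j, h⟩

lemma wdeg_update {w : Weights n} {e : Sym2 (Fin n)} (he : w e = 0) (r : ℝ) (i : Fin n)
    [Decidable (i ∈ e)] :
    wdeg (Function.update w e r) i = wdeg w i + if i ∈ e then r else 0 := by
  classical
  have h : Function.update w e r = w + r • indWeights {e} := by
    ext f
    by_cases hf : f = e
    · subst hf
      simp [indWeights, he]
    · simp [indWeights, hf]
  have h1 : wdeg (r • indWeights {e}) i = r * wdeg (indWeights {e}) i := by
    simp [wdeg, Finset.mul_sum]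
  rw [h, wdeg_add, h1, wdeg_indWeights_singleton, mul_ite, mul_one, mul_zero]

/-- What the greedy procedure guarantees after it has processed the edges in `l`: every processed
edge is either used fully or has a saturated endpoint all of whose used edges have at least the
same gain. -/
structure GreedyInvariant (b : ℝ) (c : Weights n) (l : List (Sym2 (Fin n))) (w : Weights n) :
    Prop where
  nonneg : ∀ e, 0 ≤ w e
  le_one : ∀ e, w e ≤ 1
  eq_zero : ∀ e ∉ l, w e = 0
  wdeg_le : ∀ i, wdeg w i ≤ b
  full_or_saturated : ∀ e ∈ l, w e = 1 ∨
    ∃ i ∈ e, wdeg w i = b ∧ ∀ f, i ∈ f → 0 < w f → c e ≤ c f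

/-- An edge that is not filled saturates the endpoint attaining the smaller residual demand, and by
the ordering every edge used there so far has at least its gain. Saturated vertices receive no
further weight, so the property persists. -/
lemma greedyInvariant_foldl {b : ℝ} (hb : 0 ≤ b) (c : Weights n) (l : List (Sym2 (Fin n)))
    (hnodup : l.Nodup) (hsorted : l.Pairwise fun e e' => c e' ≤ c e) :
    GreedyInvariant b c l (l.foldl (greedyStep b) 0) := by
  classical
  induction l using List.reverseRecOn with
  | nil =>
    exact ⟨fun e => le_rfl, fun e => zero_le_one, fun e _ => rfl, fun i => by simpa [wdeg] using hb,
      fun e he => absurd he List.not_mem_nil⟩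
  | append_singleton l e ih =>
    rw [List.nodup_append] at hnodup
    rw [List.pairwise_append] at hsorted
    have hel : e ∉ l := fun h => hnodup.2.2 e h e (by simp) rfl
    have hinv := ih hnodup.1 hsorted.1
    rw [List.foldl_append, List.foldl_cons, List.foldl_nil]
    set w := l.foldl (greedyStep b) 0 with hw
    have he0 : w e = 0 := hinv.eq_zero e hel
    set r := min 1 (residual b w e) with hr
    have hstep : greedyStep b w e = Function.update w e r := rfl
    have hr0 : 0 ≤ r := by
      obtain ⟨i, -, hi⟩ := exists_residual_eq b w e
      exact le_min zero_le_one (by rw [hi]; linarith [hinv.wdeg_le i])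
    have hri : ∀ i ∈ e, r ≤ b - wdeg w i := fun i hi => (min_le_right _ _).trans (residual_le hi)
    have hdeg : ∀ i, wdeg (Function.update w e r) i ≤ b := fun i => by
      rw [wdeg_update he0]
      split_ifs with hi
      · linarith [hri i hi]
      · linarith [hinv.wdeg_le i]
    rw [hstep]
    refine ⟨fun f => ?_, fun f => ?_, fun f hf => ?_, hdeg, fun f hf => ?_⟩
    · by_cases h : f = e
      · rw [h, Function.update_self]; exact hr0
      · rw [Function.update_of_ne h]; exact hinv.nonneg f
    · by_cases h : f = e
      · rw [h, Function.update_self]; exact min_le_left _ _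
      · rw [Function.update_of_ne h]; exact hinv.le_one f
    · rw [List.mem_append, not_or] at hf
      rw [Function.update_of_ne (by simpa using hf.2)]
      exact hinv.eq_zero f hf.1
    · by_cases h : f = e
      · subst h
        rw [Function.update_self]
        rcases min_choice 1 (residual b w f) with h1 | h1
        · exact Or.inl h1
        · right
          obtain ⟨i, hi, hi'⟩ := exists_residual_eq b w f
          refine ⟨i, hi, ?_, fun g _ hg => ?_⟩
          · rw [wdeg_update he0, if_pos hi, hr, h1, hi']
            ring
          · by_cases hgf : g = f
            · rw [hgf]
            · rw [Function.update_of_ne hgf] at hg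
              refine hsorted.2.2 g ?_ f (by simp)
              by_contra hgl
              exact hg.ne' (hinv.eq_zero g hgl)
      · have hfl : f ∈ l := by simpa [h] using hf
        rw [Function.update_of_ne h]
        rcases hinv.full_or_saturated f hfl with h1 | ⟨i, hi, hib, hi'⟩
        · exact Or.inl h1
        · refine Or.inr ⟨i, hi, le_antisymm (hdeg i) ?_, fun g hg hg0 => ?_⟩
          · rw [wdeg_update he0, hib]
            split_ifs <;> linarith
          · by_cases hge : g = e
            · rw [hge, Function.update_self] at hg0
              rw [hge] at hg
              linarith [hri i hg]
            · rw [Function.update_of_ne hge] at hg0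
              exact hi' g hg hg0

lemma sum_lift_add_mul (y : Fin n → ℝ) {w : Weights n} (hw : ∀ i, w s(i, i) = 0) :
    ∑ e, Sym2.lift ⟨fun i j => y i + y j, fun _ _ => add_comm _ _⟩ e * w e =
      ∑ i, y i * wdeg w i := by
  have h := sum_sum_sym2 (n := n) (f := fun e =>
    Sym2.lift ⟨fun i j => y i + y j, fun _ _ => add_comm _ _⟩ e * w e) (by simp [hw])
  have h1 : ∑ i, ∑ j, y i * w s(i, j) = ∑ i, y i * wdeg w i := by simp [wdeg, Finset.mul_sum]
  have h2 : ∑ i, ∑ j, y j * w s(i, j) = ∑ i, y i * wdeg w i := by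
    rw [Finset.sum_comm, ← h1]
    exact Finset.sum_congr rfl fun i _ => Finset.sum_congr rfl fun j _ => by rw [Sym2.eq_swap]
  simp only [Sym2.lift_mk, add_mul, Finset.sum_add_distrib, h1, h2] at h
  linarith

/-- A greedy solution has at least half of the maximal gain. The vertex potentials `y` in the proof
are dual variables. -/
lemma IsGreedySolution.isApproxSolution {p : ℝ} {G : SimpleGraph (Fin n)} {c w : Weights n}
    (hb : 0 < 2 * (n : ℝ) * p) (hc : ∀ e, 0 ≤ c e) (h : IsGreedySolution p G c w) :
    IsApproxSolution (1 / 2) p G c w := by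
  classical
  obtain ⟨l, hnodup, hl, hsorted, rfl⟩ := h
  have hinv := greedyInvariant_foldl hb.le c l hnodup hsorted
  set w := l.foldl (greedyStep (2 * n * p)) 0 with hw
  set b := 2 * (n : ℝ) * p with hbdef
  have hloop : ∀ {v : Weights n}, (∀ e, e ∉ G.edgeSet → v e = 0) → ∀ i, v s(i, i) = 0 :=
    fun hv i => hv _ (by simp)
  have hw0 : ∀ e, e ∉ G.edgeSet → w e = 0 := fun e he => hinv.eq_zero e (mt (hl e).1 he)
  refine ⟨⟨hinv.nonneg, hw0, hinv.wdeg_le, fun e _ => hinv.le_one e⟩, fun w' hw' => ?_⟩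
  -- The dual variable `y i` is the least gain of a used edge at `i` if `i` is saturated, and `0`
  -- otherwise. Positivity of `b` guarantees that a saturated vertex has a used edge.
  have hy : ∀ i, ∃ y, 0 ≤ y ∧ (∀ f, i ∈ f → 0 < w f → y ≤ c f) ∧ (wdeg w i ≠ b → y = 0) ∧
      (wdeg w i = b → ∀ t, (∀ f, i ∈ f → 0 < w f → t ≤ c f) → t ≤ y) := by
    intro i
    by_cases hi : wdeg w i = b
    · let s : Finset (Sym2 (Fin n)) := Finset.univ.filter fun f => i ∈ f ∧ 0 < w f
      have hs : s.Nonempty := by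
        by_contra hs
        rw [Finset.not_nonempty_iff_eq_empty, Finset.filter_eq_empty_iff] at hs
        have : wdeg w i ≤ 0 := Finset.sum_nonpos fun j _ =>
          not_lt.1 fun hj => hs (Finset.mem_univ s(i, j)) ⟨Sym2.mem_mk_left i j, hj⟩
        linarith
      obtain ⟨f, hf, hmin⟩ := s.exists_min_image c hs
      have hf' := (Finset.mem_filter.1 hf).2
      exact ⟨c f, hc f, fun g hg hg0 => hmin g (by simp [s, hg, hg0]), fun h => absurd hi h,
        fun _ t ht => ht f hf'.1 hf'.2⟩
    · exact ⟨0, le_rfl, fun f _ _ => hc f, fun _ => rfl, fun h => absurd h hi⟩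
  choose y hy0 hyc hyz hymax using hy
  set Y : Weights n := fun e =>
    Sym2.lift ⟨fun i j => y i + y j, fun _ _ => add_comm _ _⟩ e with hY
  have hyY : ∀ {i e}, i ∈ e → y i ≤ Y e := by
    rintro i e ⟨j, rfl⟩
    simp only [hY, Sym2.lift_mk]
    linarith [hy0 j]
  have hY2 : ∀ e, 0 < w e → Y e ≤ 2 * c e := by
    intro e he
    induction e with | _ i j => ?_
    simp only [hY, Sym2.lift_mk]
    linarith [hyc i _ (Sym2.mem_mk_left i j) he, hyc j _ (Sym2.mem_mk_right i j) he]
  -- Dual feasibility: a full edge pays its remaining gain through the slack `max 0 (c e - Y e)`,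
  -- and an edge with a saturated endpoint `i` satisfies `c e ≤ y i ≤ Y e`.
  have hedge : ∀ e, c e * w' e ≤ Y e * w' e + max 0 (c e - Y e) * w e := by
    intro e
    by_cases heG : e ∈ G.edgeSet
    · rcases hinv.full_or_saturated e ((hl e).2 heG) with h1 | ⟨i, hi, hib, hi'⟩
      · have h2 : (c e - Y e) * w' e ≤ max 0 (c e - Y e) * 1 :=
          mul_le_mul (le_max_right _ _) (hw'.2.2.2 e heG) (hw'.1 e) (le_max_left _ _)
        rw [h1]
        linarith
      · have h2 := mul_le_mul_of_nonneg_right ((hymax i hib (c e) hi').trans (hyY hi)) (hw'.1 e)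
        have h3 := mul_nonneg (le_max_left 0 (c e - Y e)) (hinv.nonneg e)
        linarith
    · rw [hw'.2.1 e heG, hw0 e heG]
      simp
  -- Complementary slackness: `y` is supported on the vertices where `w` has the maximal allowed
  -- degree.
  have hsum : ∑ e, Y e * w' e ≤ ∑ e, Y e * w e := by
    simp only [hY]
    rw [sum_lift_add_mul y (hloop hw'.2.1), sum_lift_add_mul y (hloop hw0)]
    refine Finset.sum_le_sum fun i _ => ?_
    by_cases hi : wdeg w i = b
    · rw [hi]
      exact mul_le_mul_of_nonneg_left (hw'.2.2.1 i) (hy0 i)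
    · rw [hyz i hi, zero_mul, zero_mul]
  -- On a used edge both `y i` and `y j` are at most `c e`. This is where the factor two is lost.
  have hfin : ∀ e, Y e * w e + max 0 (c e - Y e) * w e ≤ 2 * (c e * w e) := by
    intro e
    rcases (hinv.nonneg e).eq_or_lt with h0 | h0
    · rw [← h0]
      simp
    · have : Y e + max 0 (c e - Y e) ≤ 2 * c e := by
        rcases max_cases 0 (c e - Y e) with ⟨h, -⟩ | ⟨h, -⟩ <;> rw [h]
        · linarith [hY2 e h0]
        · linarith [hc e]
      nlinarith [mul_le_mul_of_nonneg_right this h0.le]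
  have h1 := Finset.sum_le_sum fun e (_ : e ∈ Finset.univ) => hedge e
  have h2 := Finset.sum_le_sum fun e (_ : e ∈ Finset.univ) => hfin e
  rw [Finset.sum_add_distrib] at h1 h2
  rw [← Finset.mul_sum] at h2
  linarith

lemma gains_nonneg {k : ℕ} (p ε : ℝ) (w : Weights n) (R : Fin n → Fin k → ℝ) (e : Sym2 (Fin n)) :
    0 ≤ gains p ε w R e :=
  matInner_nonneg (edgeLap_posSemidef e)
    (Matrix.posSemidef_self_mul_conjTranspose (normSketch p ε w R))

end Greedy

/-! ### Sketched versus exact gains. -/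

section Sketch

open Matrix

variable {n k : ℕ}

/-- The vector `exp(-η L_w) (e_i - e_j)`. -/
noncomputable def edgeVec (p ε : ℝ) (w : Weights n) (i j : Fin n) : Fin n → ℝ :=
  NormedSpace.exp (-(stepSize n p ε) • lap w) *ᵥ (Pi.single i 1 - Pi.single j 1)

/-- The total amount by which the relative errors of the sketched edge gains exceed `ε`. -/
noncomputable def excess (p ε : ℝ) (w : Weights n) (R : Fin n → Fin k → ℝ) : ℝ :=
  ∑ x ∈ (Finset.univ : Finset (Fin n)).offDiag,
    max 0 (|relError (edgeVec p ε w x.1 x.2) R| - ε)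

lemma excess_nonneg (p ε : ℝ) (w : Weights n) (R : Fin n → Fin k → ℝ) : 0 ≤ excess p ε w R :=
  Finset.sum_nonneg fun _ _ => le_max_left _ _

lemma exp_smul_lap_transpose (s : ℝ) (w : Weights n) :
    (NormedSpace.exp (-s • lap w))ᵀ = NormedSpace.exp (-s • lap w) := by
  have := (exp_posSemidef (neg_smul_lap_isHermitian s w)).1.eq
  rwa [conjTranspose_eq_transpose_of_trivial] at this

lemma sum_sq_edgeVec_ne_zero (p ε : ℝ) (w : Weights n) {i j : Fin n} (hij : i ≠ j) :
    ∑ l, edgeVec p ε w i j l ^ 2 ≠ 0 := by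
  intro h
  rw [Finset.sum_eq_zero_iff_of_nonneg fun l _ => sq_nonneg _] at h
  have h0 : edgeVec p ε w i j = 0 := by
    ext l
    exact pow_eq_zero_iff two_ne_zero |>.1 (h l (Finset.mem_univ l))
  have h1 : (Pi.single i 1 - Pi.single j 1 : Fin n → ℝ) = 0 := by
    refine mulVec_injective_of_isUnit (Matrix.isUnit_exp (-(stepSize n p ε) • lap w)) ?_
    rw [mulVec_zero]
    exact h0
  have := congrFun h1 i
  simp [hij] at this

lemma matInner_vecMulVec_mul_transpose {m : ℕ} (v : Fin n → ℝ) (B : Matrix (Fin n) (Fin m) ℝ) :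
    matInner (vecMulVec v v) (B * Bᵀ) = ∑ l, (v ᵥ* B) l ^ 2 := by
  simp only [matInner, vecMulVec_apply, Matrix.mul_apply, transpose_apply, vecMul, dotProduct, sq,
    Finset.sum_mul, Finset.mul_sum]
  rw [Finset.sum_congr rfl fun i _ => Finset.sum_comm, Finset.sum_comm]
  exact Finset.sum_congr rfl fun l _ => Finset.sum_congr rfl fun i _ =>
    Finset.sum_congr rfl fun j _ => by ring

/-- The algorithm sketches `exp(-ηL)`, but a gain is a quadratic form in `U Uᵀ`. The effective step
size of the multiplicative weights method is therefore `2η`. -/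
lemma exp_two_stepSize (p ε : ℝ) (w : Weights n) :
    NormedSpace.exp (-(2 * stepSize n p ε) • lap w) =
      NormedSpace.exp (-(stepSize n p ε) • lap w) *
        (NormedSpace.exp (-(stepSize n p ε) • lap w))ᵀ := by
  rw [exp_smul_lap_transpose, ← Matrix.exp_add_of_commute _ _ (Commute.refl _), ← add_smul]
  congr 2
  ring

lemma matInner_edgeLap_exp (p ε : ℝ) (w : Weights n) (i j : Fin n) :
    matInner (edgeLap s(i, j)) (NormedSpace.exp (-(2 * stepSize n p ε) • lap w)) =
      ∑ l, edgeVec p ε w i j l ^ 2 := by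
  rw [exp_two_stepSize, edgeLap_mk, matInner_vecMulVec_mul_transpose]
  rw [← mulVec_transpose, exp_smul_lap_transpose, edgeVec]

lemma matInner_edgeLap_sketch (p ε : ℝ) (w : Weights n) (R : Fin n → Fin k → ℝ) (i j : Fin n) :
    matInner (edgeLap s(i, j)) (sketch p ε w R * (sketch p ε w R)ᵀ) =
      ∑ l, (∑ i', R i' l * edgeVec p ε w i j i') ^ 2 := by
  rw [edgeLap_mk, matInner_vecMulVec_mul_transpose]
  refine Finset.sum_congr rfl fun l _ => ?_
  rw [sketch, ← vecMul_vecMul, ← mulVec_transpose _ (Pi.single i 1 - Pi.single j 1),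
    exp_smul_lap_transpose]
  congr 1
  simp only [vecMul, dotProduct, of_apply, edgeVec]
  exact Finset.sum_congr rfl fun i' _ => mul_comm _ _

lemma abs_relError_le (p ε : ℝ) (w : Weights n) (R : Fin n → Fin k → ℝ) {i j : Fin n}
    (hij : i ≠ j) : |relError (edgeVec p ε w i j) R| ≤ ε + excess p ε w R := by
  have hmem : (i, j) ∈ (Finset.univ : Finset (Fin n)).offDiag := by simp [hij]
  have h := Finset.single_le_sum (f := fun x : Fin n × Fin n =>
      max 0 (|relError (edgeVec p ε w x.1 x.2) R| - ε)) (fun _ _ => le_max_left _ _) hmem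
  exact sub_le_iff_le_add'.1 ((le_max_right _ _).trans h)

/-- The sketch preserves all edge gains up to a factor `1 ± (ε + excess)`. -/
lemma abs_sketch_sub_le (p ε : ℝ) (w : Weights n) (R : Fin n → Fin k → ℝ) {e : Sym2 (Fin n)}
    (he : ¬ e.IsDiag) :
    |matInner (edgeLap e) (sketch p ε w R * (sketch p ε w R)ᵀ) -
      matInner (edgeLap e) (NormedSpace.exp (-(2 * stepSize n p ε) • lap w))| ≤
      (ε + excess p ε w R) *
        matInner (edgeLap e) (NormedSpace.exp (-(2 * stepSize n p ε) • lap w)) := by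
  induction e with | _ i j => ?_
  rw [Sym2.mk_isDiag_iff] at he
  have hy := sum_sq_edgeVec_ne_zero p ε w he
  rw [matInner_edgeLap_exp, matInner_edgeLap_sketch]
  generalize hX : ∑ l, (∑ i', R i' l * edgeVec p ε w i j i') ^ 2 = X
  have hy0 : 0 ≤ ∑ l, edgeVec p ε w i j l ^ 2 := Finset.sum_nonneg fun _ _ => sq_nonneg _
  have h2 := abs_relError_le p ε w R he
  rw [relError, hX] at h2
  refine le_trans (le_of_eq ?_) (mul_le_mul_of_nonneg_right h2 hy0)
  rw [← abs_of_nonneg hy0, ← abs_mul, abs_of_nonneg hy0, sub_mul, div_mul_cancel₀ _ hy, one_mul]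

/-- The normalisation of `V` is one factor common to all edges, so it does not affect approximate
optimality. -/
lemma gains_eq (p ε : ℝ) (w : Weights n) (R : Fin n → Fin k → ℝ) (e : Sym2 (Fin n)) :
    gains p ε w R e = (matInner (projPerpOnes n) (sketch p ε w R * (sketch p ε w R)ᵀ))⁻¹ *
      matInner (edgeLap e) (sketch p ε w R * (sketch p ε w R)ᵀ) := by
  have hQ : 0 ≤ matInner (projPerpOnes n) (sketch p ε w R * (sketch p ε w R)ᵀ) :=
    matInner_nonneg projPerpOnes_posSemidef (posSemidef_self_mul_conjTranspose (sketch p ε w R))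
  rw [gains, normSketch, transpose_smul, Matrix.smul_mul, Matrix.mul_smul, smul_smul, ← mul_inv,
    Real.mul_self_sqrt hQ, matInner_smul_right]

/-- An approximate solution for the sketched gains is one for the exact gains. -/
lemma IsApproxSolution.le_matInner (hn : 2 ≤ n) {α p ε : ℝ} (hα : 0 ≤ α) (hε : 0 ≤ ε)
    {G : SimpleGraph (Fin n)} {w v v' : Weights n} {R : Fin n → Fin k → ℝ}
    (h : IsApproxSolution α p G (gains p ε w R) v) (hv' : v' ∈ feasible G p) :
    α * (1 - 2 * (ε + excess p ε w R)) *
        matInner (lap v') (NormedSpace.exp (-(2 * stepSize n p ε) • lap w)) ≤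
      matInner (lap v) (NormedSpace.exp (-(2 * stepSize n p ε) • lap w)) := by
  set W := NormedSpace.exp (-(2 * stepSize n p ε) • lap w) with hW
  set S := sketch p ε w R * (sketch p ε w R)ᵀ with hS
  set δ := ε + excess p ε w R with hδ
  have hWpsd : W.PosSemidef := exp_posSemidef (neg_smul_lap_isHermitian _ _)
  have hδ0 : 0 ≤ δ := add_nonneg hε (excess_nonneg _ _ _ _)
  have hA := matInner_nonneg (lap_posSemidef hv'.1) hWpsd
  have hB := matInner_nonneg (lap_posSemidef h.1.1) hWpsd
  -- For `δ ≥ 1/2` the claimed lower bound is nonpositive. Otherwise the normaliser is positive,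
  -- which allows the common factor to be cancelled.
  rcases le_or_gt (1 / 2) δ with hδ1 | hδ1
  · refine le_trans ?_ hB
    exact mul_nonpos_of_nonpos_of_nonneg
      (mul_nonpos_of_nonneg_of_nonpos hα (by linarith)) hA
  have hdev : ∀ e : Sym2 (Fin n), ¬ e.IsDiag →
      |matInner (edgeLap e) S - matInner (edgeLap e) W| ≤ δ * matInner (edgeLap e) W :=
    fun e he => abs_sketch_sub_le p ε w R he
  have hQ : 0 < matInner (projPerpOnes n) S := by
    have h1 := sum_nonLoops_matInner_edgeLap (by omega : n ≠ 0) S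
    have h2 := sum_nonLoops_matInner_edgeLap (by omega : n ≠ 0) W
    have h3 : (1 - δ) * ∑ e ∈ nonLoops n, matInner (edgeLap e) W ≤
        ∑ e ∈ nonLoops n, matInner (edgeLap e) S := by
      rw [Finset.mul_sum]
      refine Finset.sum_le_sum fun e he => ?_
      linarith [(abs_le.1 (hdev e (mem_nonLoops.1 he))).1]
    have h4 : 0 < matInner (projPerpOnes n) W :=
      matInner_projPerpOnes_exp_pos hn (neg_smul_lap_isHermitian _ _)
    have hn0 : (0 : ℝ) < n := by positivity
    rw [h1, h2] at h3
    have h5 : 0 < (1 - δ) * (n * matInner (projPerpOnes n) W) :=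
      mul_pos (by linarith) (mul_pos hn0 h4)
    exact pos_of_mul_pos_right (h5.trans_le h3) hn0.le
  have hsum : ∀ u : Weights n, ∑ e, gains p ε w R e * u e =
      (matInner (projPerpOnes n) S)⁻¹ * ∑ e, u e * matInner (edgeLap e) S := fun u => by
    rw [Finset.mul_sum]
    exact Finset.sum_congr rfl fun e _ => by rw [gains_eq]; ring
  have hdiag : ∀ {u : Weights n}, u ∈ feasible G p → ∀ e : Sym2 (Fin n), e.IsDiag → u e = 0 :=
    fun hu e he => hu.2.1 e fun heG => G.not_isDiag_of_mem_edgeSet heG he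
  have h1 := h.2 v' hv'
  rw [hsum, hsum, mul_left_comm, mul_le_mul_iff_right₀ (inv_pos.2 hQ)] at h1
  have h2 : (1 - δ) * matInner (lap v') W ≤ ∑ e, v' e * matInner (edgeLap e) S := by
    rw [matInner_lap, Finset.mul_sum]
    refine Finset.sum_le_sum fun e _ => ?_
    by_cases he : e.IsDiag
    · rw [hdiag hv' e he]; simp
    · rw [mul_left_comm]
      refine mul_le_mul_of_nonneg_left ?_ (hv'.1 e)
      linarith [(abs_le.1 (hdev e he)).1]
  have h3 : ∑ e, v e * matInner (edgeLap e) S ≤ (1 + δ) * matInner (lap v) W := by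
    rw [matInner_lap, Finset.mul_sum]
    refine Finset.sum_le_sum fun e _ => ?_
    by_cases he : e.IsDiag
    · rw [hdiag h.1 e he]; simp
    · rw [mul_left_comm]
      refine mul_le_mul_of_nonneg_left ?_ (h.1.1 e)
      linarith [(abs_le.1 (hdev e he)).2]
  have h4 : α * ((1 - δ) * matInner (lap v') W) ≤ (1 + δ) * matInner (lap v) W :=
    (mul_le_mul_of_nonneg_left h2 hα).trans (h1.trans h3)
  -- Uses `(1 + δ)(1 - 2δ) ≤ 1 - δ`.
  have h5 : (1 + δ) * (α * (1 - 2 * δ) * matInner (lap v') W) ≤ (1 + δ) * matInner (lap v) W := by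
    refine le_trans ?_ h4
    have h6 : 0 ≤ α * matInner (lap v') W := mul_nonneg hα hA
    nlinarith [mul_nonneg h6 (sq_nonneg δ)]
  exact le_of_mul_le_mul_left h5 (by linarith)

lemma zero_mem_feasible {p : ℝ} (hp : 0 ≤ p) (G : SimpleGraph (Fin n)) :
    (0 : Weights n) ∈ feasible G p :=
  ⟨fun _ => le_rfl, fun _ _ => rfl, fun i => by simp [wdeg]; positivity, fun _ _ => zero_le_one⟩

lemma opt_nonneg (G : SimpleGraph (Fin n)) (p : ℝ) : 0 ≤ opt G p := by
  refine Real.sSup_nonneg ?_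
  rintro _ ⟨w, hw, rfl⟩
  exact objective_nonneg hw.1

lemma objective_le_opt (hn : 2 ≤ n) {G : SimpleGraph (Fin n)} {p : ℝ} {w : Weights n}
    (hw : w ∈ feasible G p) : objective w ≤ opt G p := by
  obtain ⟨X, hX⟩ := specSet_nonempty hn
  refine le_csSup ⟨∑ e, matInner (edgeLap e) X, ?_⟩ ⟨w, hw, rfl⟩
  rintro _ ⟨v, hv, rfl⟩
  refine (objective_le hv.1 hX).trans ?_
  rw [matInner_lap]
  refine Finset.sum_le_sum fun e _ => ?_
  refine mul_le_of_le_one_left (matInner_nonneg (edgeLap_posSemidef e) hX.1) ?_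
  by_cases he : e ∈ G.edgeSet
  · exact hv.2.2.2 e he
  · rw [hv.2.1 e he]
    exact zero_le_one

/-- The normalised exponential is one particular `X ∈ Δ`, so every feasible `v'` has value at least
`objective v'` against it. Only this easy direction of the minimax relation is needed. -/
lemma IsApproxSolution.opt_mul_potential_le (hn : 2 ≤ n) {α p ε : ℝ} (hα : 0 ≤ α) (hp : 0 ≤ p)
    (hε : 0 ≤ ε) {G : SimpleGraph (Fin n)} {w v : Weights n} {R : Fin n → Fin k → ℝ}
    (h : IsApproxSolution α p G (gains p ε w R) v) :
    α * (1 - 2 * (ε + excess p ε w R)) * opt G p * potential (2 * stepSize n p ε) w ≤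
      matInner (lap v) (NormedSpace.exp (-(2 * stepSize n p ε) • lap w)) := by
  have hφ := potential_pos hn (2 * stepSize n p ε) w
  have hA := neg_smul_lap_isHermitian (2 * stepSize n p ε) w
  set β := α * (1 - 2 * (ε + excess p ε w R)) with hβ
  rcases le_or_gt β 0 with hβ0 | hβ0
  · refine le_trans ?_ (matInner_nonneg (lap_posSemidef h.1.1) (exp_posSemidef hA))
    exact mul_nonpos_of_nonpos_of_nonneg
      (mul_nonpos_of_nonpos_of_nonneg hβ0 (opt_nonneg G p)) hφ.le
  · rw [mul_assoc, mul_comm β, ← le_div_iff₀ hβ0, ← le_div_iff₀ hφ]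
    refine csSup_le ⟨_, 0, zero_mem_feasible hp G, rfl⟩ ?_
    rintro _ ⟨v', hv', rfl⟩
    rw [le_div_iff₀ hφ, le_div_iff₀ hβ0]
    have h1 := objective_le hv'.1 (exp_smul_mem_specSet hn hA)
    rw [matInner_smul_right, ← div_eq_inv_mul] at h1
    have h2 : objective v' * potential (2 * stepSize n p ε) w ≤
      matInner (lap v') (NormedSpace.exp (-(2 * stepSize n p ε) • lap w)) := (le_div_iff₀ hφ).1 h1
    have h3 := h.le_matInner hn hα hε hv'
    have h4 := mul_le_mul_of_nonneg_left h2 hβ0.le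
    linarith

end Sketch

/-! ### Regret bound for multiplicative weights. -/

section Regret

variable {n k : ℕ}

lemma accum_eq_sum (what : ℕ → Weights n) (t : ℕ) :
    accum what t = ∑ u ∈ Finset.range t, what u := by
  induction t with
  | zero => rfl
  | succ t ih => rw [accum, ih, Finset.sum_range_succ]

lemma stepSize_pos (hn : 2 ≤ n) {p ε : ℝ} (hp : 0 < p) (hε : 0 < ε) : 0 < stepSize n p ε := by
  have : (0 : ℝ) < n := by positivity
  unfold stepSize
  positivity

/-- Each round multiplies the potential by at most `1 - x ≤ exp(-x)`, where `x` is proportional to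
the guaranteed gain of that round; the bounds multiply. -/
lemma potential_accum_le (hn : 2 ≤ n) {α p ε : ℝ} (hα : 0 ≤ α) (hp : 0 < p) (hε : 0 < ε)
    (hε1 : ε ≤ 1 / 2) {G : SimpleGraph (Fin n)} {what : ℕ → Weights n}
    {R : ℕ → Fin n → Fin k → ℝ} {T : ℕ}
    (h : ∀ t < T, IsApproxSolution α p G (gains p ε (accum what t) (R t)) (what t)) :
    ∀ t ≤ T, potential (2 * stepSize n p ε) (accum what t) ≤ (n - 1) *
      Real.exp (-((1 - 2 * ε) * (2 * stepSize n p ε) * ∑ u ∈ Finset.range t,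
        α * (1 - 2 * (ε + excess p ε (accum what u) (R u))) * opt G p)) := by
  have hn0 : (0 : ℝ) < n := by positivity
  have hs := stepSize_pos hn hp hε
  -- The width of one round is `2 · 2np · 2η = 2ε`; this explains the choice of `η`.
  have hbs : 2 * (2 * n * p) * (2 * stepSize n p ε) = 2 * ε := by
    unfold stepSize
    field_simp
    ring
  intro t
  induction t with
  | zero =>
    intro _
    simp [accum, potential_zero_weights (by omega : n ≠ 0)]
  | succ t ih =>
    intro ht
    have ht' := h t (by omega)
    have h1 := potential_add_le (by omega : n ≠ 0) (s := 2 * stepSize n p ε) (b := 2 * n * p)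
      (by positivity) (by positivity) (accum what t) ht'.1.1 ht'.1.2.2.1
    have h2 := ht'.opt_mul_potential_le hn hα hp.le hε.le
    rw [hbs] at h1
    set γ := α * (1 - 2 * (ε + excess p ε (accum what t) (R t))) * opt G p with hγ
    set φ := potential (2 * stepSize n p ε) (accum what t) with hφ
    have hφ0 : 0 < φ := potential_pos hn _ _
    have h3 : potential (2 * stepSize n p ε) (accum what t + what t) ≤
        φ * Real.exp (-((1 - 2 * ε) * (2 * stepSize n p ε) * γ)) := by
      have h4 := mul_le_mul_of_nonneg_left h2
        (show 0 ≤ (1 - 2 * ε) * (2 * stepSize n p ε) from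
          mul_nonneg (by linarith) (by positivity))
      have h5 := mul_le_mul_of_nonneg_left
        (Real.add_one_le_exp (-((1 - 2 * ε) * (2 * stepSize n p ε) * γ))) hφ0.le
      linarith
    refine (h3.trans (mul_le_mul_of_nonneg_right (ih (by omega)) (Real.exp_pos _).le)).trans
      (le_of_eq ?_)
    rw [mul_assoc, ← Real.exp_add, Finset.sum_range_succ]
    congr 2
    ring

lemma output_eq (ε : ℝ) (what : ℕ → Weights n) :
    output ε what = (1 / (numIter n ε : ℝ)) • accum what (numIter n ε) := by
  rw [output, accum_eq_sum]

lemma output_mem_feasible {p ε : ℝ} (hT : numIter n ε ≠ 0) {G : SimpleGraph (Fin n)}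
    {what : ℕ → Weights n} (h : ∀ t < numIter n ε, what t ∈ feasible G p) :
    output ε what ∈ feasible G p := by
  have hT' : (0 : ℝ) < numIter n ε := by exact_mod_cast Nat.pos_of_ne_zero hT
  have hmem : ∀ t ∈ Finset.range (numIter n ε), what t ∈ feasible G p :=
    fun t ht => h t (Finset.mem_range.1 ht)
  have happ : ∀ e, output ε what e =
      (∑ t ∈ Finset.range (numIter n ε), what t e) / numIter n ε := fun e => by
    simp [output, Finset.sum_apply, div_eq_inv_mul]
  refine ⟨fun e => ?_, fun e he => ?_, fun i => ?_, fun e he => ?_⟩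
  · rw [happ]
    exact div_nonneg (Finset.sum_nonneg fun t ht => (hmem t ht).1 e) hT'.le
  · rw [happ, Finset.sum_eq_zero fun t ht => (hmem t ht).2.1 e he, zero_div]
  · have : wdeg (output ε what) i =
        (∑ t ∈ Finset.range (numIter n ε), wdeg (what t) i) / numIter n ε := by
      simp only [wdeg, happ, ← Finset.sum_div]
      rw [Finset.sum_comm]
    rw [this, div_le_iff₀ hT']
    refine (Finset.sum_le_sum fun t ht => (hmem t ht).2.2.1 i).trans (le_of_eq ?_)
    rw [Finset.sum_const, Finset.card_range, nsmul_eq_mul, mul_comm]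
  · rw [happ, div_le_iff₀ hT', one_mul]
    refine (Finset.sum_le_sum fun t ht => (hmem t ht).2.2.2 e he).trans (le_of_eq ?_)
    simp

lemma IsWellConnected.indWeights_mem_feasible {p : ℝ} {H G : SimpleGraph (Fin n)}
    (hH : IsWellConnected p H) (hHG : H ≤ G) : indWeights H.edgeSet ∈ feasible G p :=
  ⟨indWeights_nonneg _, fun _ he => Set.indicator_of_notMem
    (fun h => he (SimpleGraph.edgeSet_mono hHG h)) _, hH.1,
    fun e _ => Set.indicator_le_self' (f := 1) (fun _ _ => zero_le_one) e⟩

/-- The guarantee of the algorithm when the sketching errors are small on average and the graph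
contains a well-connected one. -/
lemma output_guarantee (hn : 2 ≤ n) {α p ε : ℝ} (hα : 0 ≤ α) (hα1 : α ≤ 1) (hp : 0 < p)
    (hε : 0 < ε) (hε1 : ε ≤ 1 / 2) {H G : SimpleGraph (Fin n)} (hH : IsWellConnected p H)
    (hHG : H ≤ G) {what : ℕ → Weights n} {R : ℕ → Fin n → Fin k → ℝ}
    (h : ∀ t < numIter n ε, IsApproxSolution α p G (gains p ε (accum what t) (R t)) (what t))
    (hexc : ∑ t ∈ Finset.range (numIter n ε), excess p ε (accum what t) (R t) ≤
      ε * numIter n ε) :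
    output ε what ∈ feasible G p ∧ (α - 7 * ε) * opt G p ≤ objective (output ε what) := by
  have hn0 : (0 : ℝ) < n := by positivity
  have hlog : 0 < Real.log n := Real.log_pos (by exact_mod_cast hn)
  have hTle : 8 * Real.log n / ε ^ 2 ≤ numIter n ε := Nat.le_ceil _
  have hT' : (0 : ℝ) < numIter n ε := lt_of_lt_of_le (by positivity) hTle
  have hT : numIter n ε ≠ 0 := by exact_mod_cast hT'.ne'
  refine ⟨output_mem_feasible hT fun t ht => (h t ht).1, ?_⟩
  have hs := stepSize_pos hn hp hε
  set T := numIter n ε with hTdef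
  set s := 2 * stepSize n p ε with hsdef
  have hopt : n * p / 4 ≤ opt G p :=
    hH.2.trans (objective_le_opt hn (hH.indWeights_mem_feasible hHG))
  have hopt0 : 0 ≤ opt G p := opt_nonneg G p
  have h1 := potential_accum_le hn hα hp hε hε1 h T le_rfl
  have hpot : potential s (accum what T) = potential (s * T) (output ε what) := by
    rw [output_eq, potential, potential, lap_smul, smul_smul]
    congr 3
    rw [← hTdef]
    field_simp
  rw [← hsdef, hpot] at h1
  have hsum : ∑ u ∈ Finset.range T,
      α * (1 - 2 * (ε + excess p ε (accum what u) (R u))) * opt G p =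
      α * (T - 2 * (ε * T + ∑ u ∈ Finset.range T, excess p ε (accum what u) (R u))) * opt G p := by
    rw [← Finset.sum_mul, ← Finset.mul_sum]
    simp only [Finset.sum_sub_distrib, ← Finset.mul_sum, Finset.sum_add_distrib, Finset.sum_const,
      Finset.card_range, nsmul_eq_mul, mul_one]
    ring
  -- The sketching tolerance and the average excess are each at most `ε`, and each enters with a
  -- factor `2`.
  have hsum' : α * (T * (1 - 4 * ε)) * opt G p ≤ ∑ u ∈ Finset.range T,
      α * (1 - 2 * (ε + excess p ε (accum what u) (R u))) * opt G p := by
    rw [hsum]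
    refine mul_le_mul_of_nonneg_right (mul_le_mul_of_nonneg_left ?_ hα) hopt0
    linarith
  have hφ := potential_pos hn (s * T) (output ε what)
  have h2 : potential (s * T) (output ε what) ≤
      n * Real.exp (-((1 - 2 * ε) * s * (α * (T * (1 - 4 * ε)) * opt G p))) := by
    refine h1.trans (mul_le_mul (by linarith) (Real.exp_le_exp.2 (neg_le_neg ?_))
      (Real.exp_pos _).le hn0.le)
    exact mul_le_mul_of_nonneg_left hsum' (mul_nonneg (by linarith) (by positivity))
  have h3 := Real.log_le_log hφ h2
  rw [Real.log_mul hn0.ne' (Real.exp_pos _).ne', Real.log_exp] at h3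
  have h4 := neg_log_potential_le hn (s := s * T) (by positivity) (output ε what)
  -- The initial potential costs at most `ε OPT` on average: `s = ε/(2pn)`, `T ≥ 8 log n / ε²` and
  -- `OPT ≥ np/4` multiply to exactly `log n`.
  have h5 : Real.log n ≤ s * T * (ε * opt G p) := by
    have h6 : ε / (2 * p * n) * (8 * Real.log n / ε ^ 2) * (ε * (n * p / 4)) = Real.log n := by
      field_simp
      ring
    have h7 : s = ε / (2 * p * n) := by
      rw [hsdef, stepSize]
      field_simp
      ring
    rw [← h6, h7]
    gcongr
  have h8 : s * T * ((α - 7 * ε) * opt G p) ≤ s * T * objective (output ε what) := by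
    -- The factors `1 - 2ε` and `1 - 4ε` lose at most `6αε ≤ 6ε`, and the initial potential loses
    -- another `ε`.
    have h9 : (α - 7 * ε) * opt G p ≤
        (1 - 2 * ε) * (α * (1 - 4 * ε)) * opt G p - ε * opt G p := by
      have : 0 ≤ (α * (8 * ε ^ 2) + 6 * ε * (1 - α)) * opt G p :=
        mul_nonneg (add_nonneg (by positivity) (mul_nonneg (by positivity) (by linarith))) hopt0
      nlinarith
    have h10 := mul_le_mul_of_nonneg_left h9 (show 0 ≤ s * T by positivity)
    linarith
  exact le_of_mul_le_mul_left h8 (by positivity)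

end Regret

/-! ### Independence of the sketches and failure probabilities. -/

section Randomness

variable {n k : ℕ}

lemma continuous_exp_lap (s : ℝ) :
    Continuous fun w : Weights n => NormedSpace.exp (-s • lap w) := by
  have h1 : Continuous fun w : Weights n => -s • lap w := by
    unfold lap
    fun_prop
  have h2 : Continuous (NormedSpace.exp : Matrix (Fin n) (Fin n) ℝ → Matrix (Fin n) (Fin n) ℝ) := by
    let : NormedRing (Matrix (Fin n) (Fin n) ℝ) := Matrix.linftyOpNormedRing
    let : NormedAlgebra ℝ (Matrix (Fin n) (Fin n) ℝ) := Matrix.linftyOpNormedAlgebra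
    let : NormedAlgebra ℚ (Matrix (Fin n) (Fin n) ℝ) := .restrictScalars ℚ ℝ _
    exact NormedSpace.exp_continuous
  exact h2.comp h1

lemma measurable_excess (p ε : ℝ) :
    Measurable fun x : Weights n × (Fin n → Fin k → ℝ) => excess p ε x.1 x.2 := by
  have h1 : ∀ i j l, Measurable fun x : Weights n × (Fin n → Fin k → ℝ) =>
      edgeVec p ε x.1 i j l := fun i j l => by
    have : Continuous fun w : Weights n => edgeVec p ε w i j l :=
      (continuous_apply l).comp ((continuous_exp_lap _).matrix_mulVec continuous_const)
    exact this.measurable.comp measurable_fst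
  have h2 : ∀ i l, Measurable fun x : Weights n × (Fin n → Fin k → ℝ) => x.2 i l := fun i l => by
    fun_prop
  unfold excess relError
  refine Finset.measurable_sum _ fun y _ => measurable_const.max (Measurable.sub_const ?_ _)
  refine (measurable_norm (α := ℝ)).comp (Measurable.sub_const (Measurable.div ?_ ?_) (1 : ℝ))
  · exact Finset.measurable_sum _ fun l _ =>
      (Finset.measurable_sum _ fun i _ => (h2 i l).mul (h1 _ _ i)).pow_const 2
  · exact Finset.measurable_sum _ fun i _ => (h1 _ _ i).pow_const 2

lemma lintegral_excess_le (hn : 2 ≤ n) (p : ℝ) {ε : ℝ} (hε : 0 < ε) (hε1 : ε ≤ 1 / 2)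
    (hk : 13312 * Real.log n / ε ^ 2 ≤ k) (w : Weights n) :
    ∫⁻ R, ENNReal.ofReal (excess p ε w R) ∂(uniformOn (signMatrices n k)) ≤
      ENNReal.ofReal (ε * ((n : ℝ) ^ 11)⁻¹) := by
  have hn0 : (0 : ℝ) < n := by positivity
  have hlog2 : Real.log 2 ≤ Real.log n := Real.log_le_log two_pos (by exact_mod_cast hn)
  have hlog : 1 / 2 < Real.log n := by linarith [Real.log_two_gt_d9]
  have hk0 : (0 : ℝ) < k := lt_of_lt_of_le (by positivity) hk
  have hk' : k ≠ 0 := by exact_mod_cast hk0.ne'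
  have hεk : 13312 * Real.log n ≤ ε ^ 2 * k := by
    rw [div_le_iff₀ (by positivity)] at hk
    linarith
  -- The constant is `13312 = 13 · 1024`: each pair of vertices contributes at most `ε n⁻¹³`, and
  -- there are fewer than `n²` ordered pairs.
  have hpair : 1024 / (ε * k) * Real.exp (-(ε ^ 2 * k / 1024)) ≤ ε * ((n : ℝ) ^ 13)⁻¹ := by
    have h1 : 1024 / (ε * k) ≤ ε := by
      rw [div_le_iff₀ (by positivity)]
      nlinarith
    have h2 : Real.exp (-(ε ^ 2 * k / 1024)) ≤ ((n : ℝ) ^ 13)⁻¹ := by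
      rw [← Real.exp_log (show (0 : ℝ) < n ^ 13 by positivity), ← Real.exp_neg, Real.exp_le_exp,
        Real.log_pow]
      push_cast
      linarith
    exact mul_le_mul h1 h2 (Real.exp_pos _).le hε.le
  refine lintegral_uniformOn_signMatrices hk' (excess_nonneg p ε w) ?_
  unfold excess
  rw [Finset.sum_comm]
  calc ∑ x ∈ (Finset.univ : Finset (Fin n)).offDiag, ∑ σ : Fin n → Fin k → Bool,
        max 0 (|relError (edgeVec p ε w x.1 x.2) (toSignMatrix σ)| - ε)
      ≤ ∑ x ∈ (Finset.univ : Finset (Fin n)).offDiag,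
          (2 ^ n) ^ k * (ε * ((n : ℝ) ^ 13)⁻¹) := by
        refine Finset.sum_le_sum fun x hx => ?_
        refine (sum_excess_le hk' (sum_sq_edgeVec_ne_zero p ε w
          (Finset.mem_offDiag.1 hx).2.2) hε hε1).trans ?_
        exact mul_le_mul_of_nonneg_left hpair (by positivity)
    _ ≤ n ^ 2 * ((2 ^ n) ^ k * (ε * ((n : ℝ) ^ 13)⁻¹)) := by
        rw [Finset.sum_const, nsmul_eq_mul]
        refine mul_le_mul_of_nonneg_right ?_ (by positivity)
        rw [Finset.offDiag_card, Finset.card_univ, Fintype.card_fin, sq]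
        exact_mod_cast Nat.sub_le _ _
    _ = (2 ^ n) ^ k * (ε * ((n : ℝ) ^ 11)⁻¹) := by
        field_simp

variable {Ω : Type*} [mΩ : MeasurableSpace Ω] {P : Measure Ω}

lemma IsRun.measurable_accum {G : Ω → SimpleGraph (Fin n)} {p ε : ℝ}
    {solves : SimpleGraph (Fin n) → Weights n → Weights n → Prop} {ℱ : Filtration ℕ mΩ}
    {R : ℕ → Ω → Fin n → Fin k → ℝ} {what : ℕ → Ω → Weights n}
    (hrun : IsRun P G p ε solves ℱ R what) :
    ∀ t ≤ numIter n ε, Measurable[ℱ t] fun ω => accum (fun s => what s ω) t := by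
  intro t
  induction t with
  | zero => exact fun _ => measurable_const
  | succ t ih =>
    intro ht
    exact ((ih (by omega)).mono (ℱ.mono (Nat.le_succ t)) le_rfl).add
      (hrun.answer_measurable t (by omega))

/-- Fresh randomness: the expected excess of each iteration is tiny. -/
lemma IsRun.lintegral_excess_le [IsProbabilityMeasure P] (hn : 2 ≤ n)
    {G : Ω → SimpleGraph (Fin n)} {p ε : ℝ} (hε : 0 < ε) (hε1 : ε ≤ 1 / 2)
    (hk : 13312 * Real.log n / ε ^ 2 ≤ k)
    {solves : SimpleGraph (Fin n) → Weights n → Weights n → Prop} {ℱ : Filtration ℕ mΩ}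
    {R : ℕ → Ω → Fin n → Fin k → ℝ} {what : ℕ → Ω → Weights n}
    (hrun : IsRun P G p ε solves ℱ R what) {t : ℕ} (ht : t < numIter n ε) :
    ∫⁻ ω, ENNReal.ofReal (excess p ε (accum (fun s => what s ω) t) (R t ω)) ∂P ≤
      ENNReal.ofReal (ε * ((n : ℝ) ^ 11)⁻¹) := by
  have hA' := hrun.measurable_accum t ht.le
  have hA : Measurable fun ω => accum (fun s => what s ω) t := hA'.mono (ℱ.le t) le_rfl
  have hR : Measurable (R t) := (hrun.sample_measurable t ht).mono (ℱ.le _) le_rfl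
  -- The accumulated weights are determined by the past, hence independent of the fresh sketch. On
  -- the product space the estimate for fixed weights can be integrated.
  have hind : IndepFun (fun ω => accum (fun s => what s ω) t) (R t) P := by
    rw [IndepFun_iff_Indep]
    exact indep_of_indep_of_le_left (hrun.sample_indep t ht).symm hA'.comap_le
  have hmap := (indepFun_iff_map_prod_eq_prod_map_map hA.aemeasurable hR.aemeasurable).1 hind
  have hf : Measurable fun x : Weights n × (Fin n → Fin k → ℝ) =>
      ENNReal.ofReal (excess p ε x.1 x.2) := (measurable_excess p ε).ennreal_ofReal
  have := Measure.isProbabilityMeasure_map (μ := P) hA.aemeasurable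
  have := Measure.isProbabilityMeasure_map (μ := P) hR.aemeasurable
  calc ∫⁻ ω, ENNReal.ofReal (excess p ε (accum (fun s => what s ω) t) (R t ω)) ∂P
      = ∫⁻ x, ENNReal.ofReal (excess p ε x.1 x.2)
          ∂(P.map fun ω => (accum (fun s => what s ω) t, R t ω)) :=
        (lintegral_map hf (hA.prodMk hR)).symm
    _ = ∫⁻ w, ∫⁻ r, ENNReal.ofReal (excess p ε w r) ∂(P.map (R t))
          ∂(P.map fun ω => accum (fun s => what s ω) t) := by
        rw [hmap, lintegral_prod _ hf.aemeasurable]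
    _ ≤ ∫⁻ _, ENNReal.ofReal (ε * ((n : ℝ) ^ 11)⁻¹)
          ∂(P.map fun ω => accum (fun s => what s ω) t) := by
        refine lintegral_mono fun w => ?_
        rw [(hrun.sample_law t ht).map_eq]
        exact MMWU.lintegral_excess_le hn p hε hε1 hk w
    _ = ENNReal.ofReal (ε * ((n : ℝ) ^ 11)⁻¹) := by simp

/-- Markov's inequality for the total excess. Both the expectation bound and the threshold are
proportional to `ε T`, so the number of rounds cancels. -/
lemma IsRun.measure_lt_sum_excess_le [IsProbabilityMeasure P] (hn : 2 ≤ n)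
    {G : Ω → SimpleGraph (Fin n)} {p ε : ℝ} (hε : 0 < ε) (hε1 : ε ≤ 1 / 2)
    (hk : 13312 * Real.log n / ε ^ 2 ≤ k)
    {solves : SimpleGraph (Fin n) → Weights n → Weights n → Prop} {ℱ : Filtration ℕ mΩ}
    {R : ℕ → Ω → Fin n → Fin k → ℝ} {what : ℕ → Ω → Weights n}
    (hrun : IsRun P G p ε solves ℱ R what) :
    P {ω | ε * numIter n ε < ∑ t ∈ Finset.range (numIter n ε),
      excess p ε (accum (fun s => what s ω) t) (R t ω)} ≤ ENNReal.ofReal (((n : ℝ) ^ 11)⁻¹) := by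
  have hlog : 0 < Real.log n := Real.log_pos (by exact_mod_cast hn)
  have hT' : (0 : ℝ) < numIter n ε := lt_of_lt_of_le (by positivity) (Nat.le_ceil _)
  have hmeas : ∀ t ∈ Finset.range (numIter n ε), Measurable fun ω =>
      ENNReal.ofReal (excess p ε (accum (fun s => what s ω) t) (R t ω)) := fun t ht => by
    have ht := Finset.mem_range.1 ht
    exact ((measurable_excess p ε).comp
      (((hrun.measurable_accum t ht.le).mono (ℱ.le t) le_rfl).prodMk
        ((hrun.sample_measurable t ht).mono (ℱ.le _) le_rfl))).ennreal_ofReal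
  have hεT : 0 < ε * numIter n ε := by positivity
  calc P {ω | ε * numIter n ε < ∑ t ∈ Finset.range (numIter n ε),
        excess p ε (accum (fun s => what s ω) t) (R t ω)}
      ≤ P {ω | ENNReal.ofReal (ε * numIter n ε) ≤ ∑ t ∈ Finset.range (numIter n ε),
        ENNReal.ofReal (excess p ε (accum (fun s => what s ω) t) (R t ω))} := by
        refine measure_mono fun ω hω => ?_
        rw [Set.mem_ofPred_eq, ← ENNReal.ofReal_sum_of_nonneg fun t _ => excess_nonneg _ _ _ _]
        exact ENNReal.ofReal_le_ofReal (le_of_lt hω)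
    _ ≤ (∫⁻ ω, ∑ t ∈ Finset.range (numIter n ε),
        ENNReal.ofReal (excess p ε (accum (fun s => what s ω) t) (R t ω)) ∂P) /
          ENNReal.ofReal (ε * numIter n ε) :=
        meas_ge_le_lintegral_div (Finset.measurable_sum _ hmeas).aemeasurable
          (by simpa using hεT) ENNReal.ofReal_ne_top
    _ ≤ (∑ _t ∈ Finset.range (numIter n ε), ENNReal.ofReal (ε * ((n : ℝ) ^ 11)⁻¹)) /
          ENNReal.ofReal (ε * numIter n ε) := by
        refine ENNReal.div_le_div_right ?_ _
        rw [lintegral_finsetSum _ hmeas]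
        exact Finset.sum_le_sum fun t ht =>
          hrun.lintegral_excess_le hn hε hε1 hk (Finset.mem_range.1 ht)
    _ = ENNReal.ofReal (((n : ℝ) ^ 11)⁻¹) := by
        rw [← ENNReal.ofReal_sum_of_nonneg fun _ _ => by positivity,
          ← ENNReal.ofReal_div_of_pos hεT, Finset.sum_const, Finset.card_range, nsmul_eq_mul]
        congr 1
        field_simp

/-- The main estimate, for any oracle whose answers are `α`-approximate solutions. -/
lemma IsRun.measure_failure_le [IsProbabilityMeasure P] (hn : 2 ≤ n) {α β ε : ℝ} (hα : 0 ≤ α)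
    (hα1 : α ≤ 1) (hβ : β ≤ α - 7 * ε) (p : unitInterval) (hp : 208 * Real.log n / n ≤ (p : ℝ)) (hε : 0 < ε)
    (hε1 : ε ≤ 1 / 2) (hk : 13312 * Real.log n / ε ^ 2 ≤ k)
    {GER GSR : Ω → SimpleGraph (Fin n)}
    (hlaw : HasLaw GER (SimpleGraph.binomialRandom (Fin n) p) P) (hle : ∀ ω, GER ω ≤ GSR ω)
    {solves : SimpleGraph (Fin n) → Weights n → Weights n → Prop} {ℱ : Filtration ℕ mΩ}
    {R : ℕ → Ω → Fin n → Fin k → ℝ} {what : ℕ → Ω → Weights n}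
    (hrun : IsRun P GSR p ε solves ℱ R what)
    (hsolves : ∀ G c w, (∀ e, 0 ≤ c e) → solves G c w → IsApproxSolution α p G c w) :
    P {ω | ¬ (output ε (fun t => what t ω) ∈ feasible (GSR ω) p ∧
      β * opt (GSR ω) p ≤ objective (output ε (fun t => what t ω)))} ≤
      ENNReal.ofReal (((n : ℝ) ^ 10)⁻¹) := by
  have hn0 : (0 : ℝ) < n := by positivity
  have hlog : 0 < Real.log n := Real.log_pos (by exact_mod_cast hn)
  have hp0 : (0 : ℝ) < p := lt_of_lt_of_le (by positivity) hp
  have hsub : {ω | ¬ (output ε (fun t => what t ω) ∈ feasible (GSR ω) p ∧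
      β * opt (GSR ω) p ≤ objective (output ε (fun t => what t ω)))} ⊆
      (GER ⁻¹' {G | ¬ IsWellConnected p G}) ∪
      {ω | ε * numIter n ε < ∑ t ∈ Finset.range (numIter n ε),
        excess p ε (accum (fun s => what s ω) t) (R t ω)} := by
    intro ω hω
    by_contra hcon
    rw [Set.mem_union, not_or, Set.mem_preimage, Set.mem_ofPred_eq, not_not, Set.mem_ofPred_eq,
      not_lt] at hcon
    have h := output_guarantee hn hα hα1 hp0 hε hε1 hcon.1 (hle ω)
      (fun t ht => hsolves _ _ _ (gains_nonneg _ _ _ _) (hrun.answer_solves t ht ω)) hcon.2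
    exact hω ⟨h.1, (mul_le_mul_of_nonneg_right hβ (opt_nonneg _ _)).trans h.2⟩
  have hgraph : P (GER ⁻¹' {G | ¬ IsWellConnected p G}) ≤ ENNReal.ofReal (((n : ℝ) ^ 11)⁻¹) := by
    -- This direction of the comparison with the law of the graph requires no measurability of the
    -- bad set of graphs.
    refine (Measure.le_map_apply hlaw.aemeasurable _).trans ?_
    rw [hlaw.map_eq]
    exact binomialRandom_not_isWellConnected hn p hp
  refine (measure_mono hsub).trans ((measure_union_le _ _).trans
    ((add_le_add hgraph (hrun.measure_lt_sum_excess_le hn hε hε1 hk)).trans ?_))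
  rw [← ENNReal.ofReal_add (by positivity) (by positivity)]
  refine ENNReal.ofReal_le_ofReal ?_
  have h2 : (2 : ℝ) ≤ n := by exact_mod_cast hn
  calc ((n : ℝ) ^ 11)⁻¹ + ((n : ℝ) ^ 11)⁻¹ = 2 * ((n : ℝ) ^ 11)⁻¹ := by ring
    _ ≤ n * ((n : ℝ) ^ 11)⁻¹ := by gcongr
    _ = ((n : ℝ) ^ 10)⁻¹ := by field_simp

end Randomness

end MMWU

theorem mainTheorem5 :
    ∃ C₀ > (0 : ℝ), ∃ C₁ > (0 : ℝ), ∃ C₂ > (0 : ℝ),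
      ∀ (n : ℕ) (p : unitInterval) (ε : ℝ) (k : ℕ),
        2 ≤ n → C₁ * Real.log n / n ≤ (p : ℝ) → 0 < ε → ε ≤ 1 / 2 →
        C₂ * Real.log n / ε ^ 2 ≤ (k : ℝ) →
        ∀ (Ω : Type*) [mΩ : MeasurableSpace Ω] (P : Measure Ω) [IsProbabilityMeasure P]
          (GER GSR : Ω → SimpleGraph (Fin n)),
          HasLaw GER (SimpleGraph.binomialRandom (Fin n) p) P →
          (∀ ω, GER ω ≤ GSR ω) →
          ∀ (ℱ : Filtration ℕ mΩ) (R : ℕ → Ω → Fin n → Fin k → ℝ)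
            (what : ℕ → Ω → MMWU.Weights n),
            -- the oracle is a `(1 - ε)`-approximate LP solver
            (MMWU.IsRun P GSR p ε (MMWU.IsApproxSolution (1 - ε) p) ℱ R what →
              P {ω | ¬ (MMWU.output ε (fun t => what t ω) ∈ MMWU.feasible (GSR ω) p ∧
                  (1 - C₀ * ε) * MMWU.opt (GSR ω) p ≤
                    MMWU.objective (MMWU.output ε (fun t => what t ω)))} ≤
                ENNReal.ofReal (((n : ℝ) ^ 10)⁻¹)) ∧
            -- the oracle is any `1/2`-approximate solver
            (MMWU.IsRun P GSR p ε (MMWU.IsApproxSolution (1 / 2) p) ℱ R what →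
              P {ω | ¬ (MMWU.output ε (fun t => what t ω) ∈ MMWU.feasible (GSR ω) p ∧
                  (1 / 2 - C₀ * ε) * MMWU.opt (GSR ω) p ≤
                    MMWU.objective (MMWU.output ε (fun t => what t ω)))} ≤
                ENNReal.ofReal (((n : ℝ) ^ 10)⁻¹)) ∧
            -- the oracle is the greedy procedure
            (MMWU.IsRun P GSR p ε (MMWU.IsGreedySolution p) ℱ R what →
              P {ω | ¬ (MMWU.output ε (fun t => what t ω) ∈ MMWU.feasible (GSR ω) p ∧
                  (1 / 2 - C₀ * ε) * MMWU.opt (GSR ω) p ≤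
                    MMWU.objective (MMWU.output ε (fun t => what t ω)))} ≤
                ENNReal.ofReal (((n : ℝ) ^ 10)⁻¹)) := by
  -- An `α`-approximate oracle yields `α - 7ε`. For `α = 1 - ε` this is `1 - 8ε`, whence `C₀ = 8`.
  refine ⟨8, by norm_num, 208, by norm_num, 13312, by norm_num, ?_⟩
  intro n p ε k hn hp hε hε1 hk Ω mΩ P _ GER GSR hlaw hle ℱ R what
  have hn0 : (0 : ℝ) < n := by positivity
  have hp0 : (0 : ℝ) < p :=
    lt_of_lt_of_le (div_pos (mul_pos (by norm_num) (Real.log_pos (by exact_mod_cast hn))) hn0) hp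
  refine ⟨fun hrun => ?_, fun hrun => ?_, fun hrun => ?_⟩
  · exact hrun.measure_failure_le hn (by linarith) (by linarith) (by linarith) p hp hε hε1 hk hlaw
      hle fun _ _ _ _ h => h
  · exact hrun.measure_failure_le hn (by norm_num) (by norm_num) (by linarith) p hp hε hε1 hk hlaw
      hle fun _ _ _ _ h => h
  · exact hrun.measure_failure_le hn (by norm_num) (by norm_num) (by linarith) p hp hε hε1 hk hlaw
      hle fun _ _ _ hc h => h.isApproxSolution (by positivity) hc
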